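/- Let $m\ge 3$ and let $Q^m=\{[z]\in\mathbb{C}P^{m+1} : z_1^2+\dots+z_{m+2}^2=0\}$ be the complex quadric, with the complex structure $J$ and the Riemannian metric $g$ induced from the Fubini–Study metric of constant holomorphic sectional curvature $4$ on $\mathbb{C}P^{m+1}$. Let $\bar\nabla$ be its Levi-Civita connection and $\bar R(X,Y)Z=\bar\nabla_X\bar\nabla_YZ-\bar\nabla_Y\bar\nabla_XZ-\bar\nabla_{[X,Y]}Z$ its curvature tensor. For a (smooth, non-empty, immersed) real hypersurface $M$ of $Q^m$, that is, one of real dimension $2m-1$, let $\nabla$ be the Levi-Civita connection of the induced metric, $N$ a local unit normal vector field, $\xi=-JN$ the Reeb vector field, $SX=-\bar\nabla_XN$ the shape operator and $\bar R_N Y=\bar R(Y,N)N$ the normal Jacobi operator, regarded as an endomorphism field of $TM$. Call $M$ Hopf if $\xi$ is everywhere an eigenvector of $S$, and call $\bar R_N$ $\mathcal{C}$-parallel if $(\nabla_X\bar R_N)Y=\nabla_X(\bar R_NY)-\bar R_N(\nabla_XY)=0$ for every tangent vector $X$ of $M$ orthogonal to $\xi$ and every tangent vector field $Y$ of $M$.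 Then there is no Hopf real hypersurface of $Q^m$ whose normal Jacobi operator is $\mathcal{C}$-parallel. -/

import Mathlib

open scoped Manifold ContDiff Matrix Matrix.Norms.Frobenius LinearAlgebra.Projectivization

noncomputable section

namespace ComplexQuadric

/-- Homogeneous coordinates: the points of `ℂP^{m+1}` are the lines in `ℂ^{m+2}`. -/
abbrev CP (m : ℕ) : Type := ℙ ℂ (Fin (m + 2) → ℂ)

/-- Complex `(m+2) × (m+2)` matrices. The type carries the usual algebra and conjugate transpose
(written `star`) of matrices. Its norm is the Frobenius norm; it is used only for derivatives, for
which every norm gives the same. The Riemannian metric is `metric` below. -/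
def Mat (m : ℕ) : Type := Matrix (Fin (m + 2)) (Fin (m + 2)) ℂ

instance (m : ℕ) : NormedRing (Mat m) :=
  inferInstanceAs (NormedRing (Matrix (Fin (m + 2)) (Fin (m + 2)) ℂ))

instance (m : ℕ) : NormedAlgebra ℂ (Mat m) :=
  inferInstanceAs (NormedAlgebra ℂ (Matrix (Fin (m + 2)) (Fin (m + 2)) ℂ))

instance (m : ℕ) : StarRing (Mat m) :=
  inferInstanceAs (StarRing (Matrix (Fin (m + 2)) (Fin (m + 2)) ℂ))

variable {m : ℕ}

/-- The trace of a matrix. -/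
def tr (X : Mat m) : ℂ := Matrix.trace X

/-- The transpose of a matrix. -/
def transp (X : Mat m) : Mat m := Matrix.transpose X

/-- The rank one matrix `v w*`. -/
def outer (v w : Fin (m + 2) → ℂ) : Mat m := Matrix.vecMulVec v (star w)

/-- The complex quadric `Q^m = { [z] : z₁² + ⋯ + z_{m+2}² = 0 }` in `ℂP^{m+1}`. -/
def quadric (m : ℕ) : Set (CP m) := {p | ∀ z ∈ p.submodule, z ⬝ᵥ z = 0}

/-- The standard embedding of `ℂP^{m+1}` into the Hermitian matrices: the line `[z]` goes to the
matrix `z z* / |z|²` of the orthogonal projection of `ℂ^{m+2}` onto `[z]`. It is a smooth embedding,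
and it is isometric for the Fubini-Study metric of constant holomorphic sectional curvature `4` on
`ℂP^{m+1}` and the inner product `metric` below on matrices. Points, tangent vectors and vector
fields of `ℂP^{m+1}` and `Q^m` are handled through this embedding. -/
def lineMatrix (p : CP m) : Mat m :=
  (star p.rep ⬝ᵥ p.rep)⁻¹ • outer p.rep p.rep

/-- The inner product `g(X, Y) = ½ Re tr(X Y*)`. For `|z| = 1` and `v, w` orthogonal to `z`, the
tangent vectors `v z* + z v*` and `w z* + z w*` of `ℂP^{m+1}` at `[z]` have the product
`Re ⟨v, w⟩`, as for the Fubini-Study metric of holomorphic sectional curvature `4`. -/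
def metric (X Y : Mat m) : ℝ := (1 / 2) * (tr (X * star Y)).re

/-- The tangent space `T_{[z]} Q^m`: the vectors `v` in `ℂ^{m+2} ⊖ (ℂ z ⊕ ℂ z̄)`, where `v` is
identified with the derivative `v z* + z v*` of the line matrix in the direction of `v`. -/
def tangentSpace (p : CP m) : Set (Mat m) :=
  {X | ∃ v : Fin (m + 2) → ℂ, star p.rep ⬝ᵥ v = 0 ∧ p.rep ⬝ᵥ v = 0 ∧
    X = outer v p.rep + outer p.rep v}

/-- For `P` the line matrix of a point `[z]` of `Q^m`, the `metric`-orthogonal projection of the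
space of all matrices onto `T_{[z]} Q^m`. Here `1 - P - transp P` is the orthogonal projection of
`ℂ^{m+2}` onto `ℂ^{m+2} ⊖ (ℂ z ⊕ ℂ z̄)`, and `(X + X*)/2` is the Hermitian part of `X`. The formula
makes sense for every matrix `P`, so that it also extends tangent vectors to vector fields. -/
def tangentProj (P X : Mat m) : Mat m :=
  (1 / 2 : ℂ) • ((1 - P - transp P) * (X + star X) * P + P * (X + star X) * (1 - P - transp P))

/-- The complex structure of `Q^m` at the point with line matrix `P`; it sends the tangent vector
`v z* + z v*` to `(i v) z* + z (i v)*`. -/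
def complexStructure (P X : Mat m) : Mat m := Complex.I • (X * P - P * X)

/-- The Levi-Civita connection `∇̄_X Y` of `Q^m`, for vector fields `X`, `Y` on the space of matrices
that are tangent to `Q^m` along `Q^m`: the tangential part of the derivative of `Y` along `X`.
At points of `Q^m` it depends only on the restrictions of `X` and `Y` to `Q^m`. -/
def cov (X Y : Mat m → Mat m) (P : Mat m) : Mat m := tangentProj P (fderiv ℝ Y P (X P))

/-- `∇̄_X ∇̄_Y Z - ∇̄_Y ∇̄_X Z - ∇̄_{[X,Y]} Z` for vector fields tangent to `Q^m` along `Q^m`. -/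
def curvatureField (X Y Z : Mat m → Mat m) (P : Mat m) : Mat m :=
  cov X (cov Y Z) P - cov Y (cov X Z) P - cov (VectorField.lieBracket ℝ X Y) Z P

/-- The Riemannian curvature tensor `R̄(x, y)z` of `Q^m` at the point with line matrix `P`, computed
on the extensions `P' ↦ tangentProj P' x` of the tangent vectors `x` to vector fields. -/
def curvature (P x y z : Mat m) : Mat m :=
  curvatureField (fun P' => tangentProj P' x) (fun P' => tangentProj P' y)
    (fun P' => tangentProj P' z) P

/-! ### Real hypersurfaces of `Q^m` -/

/-- The model space of a real hypersurface of `Q^m`, of real dimension `2m - 1`. -/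
abbrev Model (m : ℕ) : Type := EuclideanSpace ℝ (Fin (2 * m - 1))

variable {M : Type*} [TopologicalSpace M] [ChartedSpace (Model m) M]

/-- A map from a manifold to `ℂP^{m+1}`, composed with the standard embedding into matrices. -/
def emb (f : M → CP m) (x : M) : Mat m := lineMatrix (f x)

/-- The derivative at `x`, in the direction of the tangent vector `v` of `M`, of a map from `M` to
the space of matrices. -/
def dir (Y : M → Mat m) (x : M) (v : TangentSpace 𝓘(ℝ, Model m) x) : Mat m :=
  mvfderiv 𝓘(ℝ, Model m) Y x v

/-- `f` makes the `(2m-1)`-dimensional manifold `M` an (immersed, smooth) real hypersurface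
of `Q^m`. -/
structure IsRealHypersurface (f : M → CP m) : Prop where
  mem_quadric : ∀ x, f x ∈ quadric m
  smooth : ContMDiff 𝓘(ℝ, Model m) 𝓘(ℝ, Mat m) ∞ (emb f)
  immersion : ∀ x, Function.Injective (dir (emb f) x)

/-- `N` is a smooth unit normal vector field, in `Q^m`, of the hypersurface on the set `U`. -/
structure IsUnitNormalOn (f : M → CP m) (U : Set M) (N : M → Mat m) : Prop where
  smooth : ContMDiffOn 𝓘(ℝ, Model m) 𝓘(ℝ, Mat m) ∞ N U
  tangent_quadric : ∀ x ∈ U, N x ∈ tangentSpace (f x)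
  unit : ∀ x ∈ U, metric (N x) (N x) = 1
  normal : ∀ x ∈ U, ∀ v, metric (N x) (dir (emb f) x v) = 0

/-- `Y` is a smooth tangent vector field of the hypersurface on `U`, with tangent vectors of `M`
identified with their images under the derivative of the immersion. -/
structure IsTangentFieldOn (f : M → CP m) (U : Set M) (Y : M → Mat m) : Prop where
  smooth : ContMDiffOn 𝓘(ℝ, Model m) 𝓘(ℝ, Mat m) ∞ Y U
  tangent : ∀ x ∈ U, Y x ∈ Set.range (dir (emb f) x)

/-- The Reeb vector field `ξ = -J N`. -/
def reeb (f : M → CP m) (N : M → Mat m) (x : M) : Mat m := -complexStructure (emb f x) (N x)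

/-- `∇̄_v Y` for a vector field `Y` of `Q^m` along the hypersurface and a tangent vector `v` of `M`,
with `∇̄` the Levi-Civita connection of `Q^m`. -/
def covAlong (f : M → CP m) (Y : M → Mat m) (x : M) (v : TangentSpace 𝓘(ℝ, Model m) x) : Mat m :=
  tangentProj (emb f x) (dir Y x v)

/-- The shape operator `S v = -∇̄_v N` (Weingarten formula). -/
def shape (f : M → CP m) (N : M → Mat m) (x : M) (v : TangentSpace 𝓘(ℝ, Model m) x) : Mat m :=
  -covAlong f N x v

/-- The Levi-Civita connection `∇_v Y` of the hypersurface, for a tangent vector field `Y` of it: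
the part of `∇̄_v Y` tangent to the hypersurface (Gauss formula). -/
def covHyp (f : M → CP m) (N Y : M → Mat m) (x : M) (v : TangentSpace 𝓘(ℝ, Model m) x) : Mat m :=
  covAlong f Y x v - metric (covAlong f Y x v) (N x) • N x

/-- The normal Jacobi operator `R̄_N Y = R̄(Y, N) N` at the point `x`. -/
def normalJacobi (f : M → CP m) (N : M → Mat m) (x : M) (Y : Mat m) : Mat m :=
  curvature (emb f x) Y (N x) (N x)

/-- `(∇_v R̄_N) Y = ∇_v (R̄_N Y) - R̄_N (∇_v Y)`. -/
def covNormalJacobi (f : M → CP m) (N Y : M → Mat m) (x : M)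
    (v : TangentSpace 𝓘(ℝ, Model m) x) : Mat m :=
  covHyp f N (fun x' => normalJacobi f N x' (Y x')) x v - normalJacobi f N x (covHyp f N Y x v)

/-- The hypersurface is Hopf: for every local unit normal field the Reeb vector field is principal
for the shape operator, `S ξ = α ξ`. -/
def IsHopf (f : M → CP m) : Prop :=
  ∀ (U : Set M) (N : M → Mat m), IsOpen U → IsUnitNormalOn f U N → ∀ x ∈ U,
    ∃ (v : TangentSpace 𝓘(ℝ, Model m) x) (α : ℝ),
      dir (emb f) x v = reeb f N x ∧ shape f N x v = α • reeb f N x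

/-- The normal Jacobi operator is `𝒞`-parallel: for every local unit normal field `N` and local
tangent vector field `Y` of the hypersurface, `(∇_v R̄_N) Y = 0` for all tangent vectors `v` of the
hypersurface that are orthogonal to `ξ`. -/
def HasCParallelNormalJacobi (f : M → CP m) : Prop :=
  ∀ (U : Set M) (N Y : M → Mat m), IsOpen U → IsUnitNormalOn f U N → IsTangentFieldOn f U Y →
    ∀ x ∈ U, ∀ v : TangentSpace 𝓘(ℝ, Model m) x,
      metric (dir (emb f) x v) (reeb f N x) = 0 → covNormalJacobi f N Y x v = 0

end ComplexQuadric

end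

set_option linter.unusedSimpArgs false

noncomputable section

namespace ComplexQuadric

variable {m : ℕ}

/-! Points of the quadric are the projections `P` = z z* with |z| = 1 and z·z = 0, and its curvature
is R(x, y)w = [[x, y] - [x, y]ᵗ, w] (`curvature_eq`). No `P` occurs in this formula, so the
tangential derivative of R(Y, N)N only differentiates Y and N; this is the local symmetry of the
quadric. For v ⊥ ξ, put W = -Sv. Then 𝒞-parallelism says that R(Y, W)N + R(Y, N)W is a multiple of N
for every Y tangent to the hypersurface (`exists_curvForm_eq`).

The Hopf condition and the symmetry of S give W ⊥ ξ. Testing the identity on a Y complex-orthogonal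
to N and its conjugate, and then on Y = ξ, forces W = 0 (`eq_zero_of_curvVec`). Hence S vanishes on
ξ^⊥ (`tangentProj_fderiv_normal`).

This contradicts the Codazzi equation. Let η = g(·, ξ). Then g(S·, ξ) = αη, and dη vanishes on pairs
from ξ^⊥ because S vanishes there, so d(αη) vanishes on such pairs too. By Codazzi, however, its
value on the pair x, Jx is a curvature component that is nonzero when x is complex-orthogonal to N
and its conjugate. `not_isHopf_and_isCParallel` carries this out with symmetric second derivatives
in the flat space of matrices. What remains is local: smooth unit normals exist, and charts turn a
hypersurface into a parametrized patch. -/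

instance : StarModule ℂ (Mat m) :=
  inferInstanceAs (StarModule ℂ (Matrix (Fin (m + 2)) (Fin (m + 2)) ℂ))

instance : FiniteDimensional ℂ (Mat m) :=
  inferInstanceAs (FiniteDimensional ℂ (Matrix (Fin (m + 2)) (Fin (m + 2)) ℂ))

instance : FiniteDimensional ℝ (Mat m) := FiniteDimensional.complexToReal (Mat m)

/-! ### Matrix calculus -/

theorem outer_mul_outer (v w u t : Fin (m + 2) → ℂ) :
    outer v w * outer u t = (star w ⬝ᵥ u) • outer v t :=
  (Matrix.vecMulVec_mul_vecMulVec v (star w) u (star t)).trans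
    (by rw [Matrix.vecMulVec_smul]; rfl)

theorem star_outer (v w : Fin (m + 2) → ℂ) : star (outer v w) = outer w v := by
  refine (Matrix.ext fun i j => ?_ : (star (Matrix.vecMulVec v (star w)) : Matrix _ _ ℂ) =
    Matrix.vecMulVec w (star v))
  simp [Matrix.star_apply, Matrix.vecMulVec_apply, mul_comm]

theorem transp_outer (v w : Fin (m + 2) → ℂ) : transp (outer v w) = outer (star w) (star v) := by
  refine (Matrix.ext fun i j => ?_ : (Matrix.transpose (Matrix.vecMulVec v (star w)) :
    Matrix _ _ ℂ) = Matrix.vecMulVec (star w) (star (star v)))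
  simp [Matrix.vecMulVec_apply, mul_comm]

theorem tr_outer (v w : Fin (m + 2) → ℂ) : tr (outer v w) = star w ⬝ᵥ v :=
  (Matrix.trace_vecMulVec v (star w)).trans (dotProduct_comm _ _)

theorem transp_mul (X Y : Mat m) : transp (X * Y) = transp Y * transp X :=
  Matrix.transpose_mul X Y

theorem transp_add (X Y : Mat m) : transp (X + Y) = transp X + transp Y :=
  Matrix.transpose_add X Y

theorem transp_sub (X Y : Mat m) : transp (X - Y) = transp X - transp Y :=
  Matrix.transpose_sub X Y

theorem transp_transp (X : Mat m) : transp (transp X) = X := Matrix.transpose_transpose X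

theorem star_transp (X : Mat m) : star (transp X) = transp (star X) := rfl

theorem tr_add (X Y : Mat m) : tr (X + Y) = tr X + tr Y := Matrix.trace_add X Y

theorem tr_smul (c : ℂ) (X : Mat m) : tr (c • X) = c * tr X := Matrix.trace_smul c X

theorem tr_mul_comm (X Y : Mat m) : tr (X * Y) = tr (Y * X) := Matrix.trace_mul_comm X Y

theorem tr_star (X : Mat m) : tr (star X) = star (tr X) := Matrix.trace_conjTranspose X

theorem outer_add_left (u v w : Fin (m + 2) → ℂ) : outer (u + v) w = outer u w + outer v w :=
  Matrix.add_vecMulVec u v (star w)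

theorem outer_add_right (u v w : Fin (m + 2) → ℂ) : outer w (u + v) = outer w u + outer w v := by
  unfold outer; rw [star_add]; exact Matrix.vecMulVec_add _ _ _

theorem outer_sub_left (u v w : Fin (m + 2) → ℂ) : outer (u - v) w = outer u w - outer v w :=
  Matrix.sub_vecMulVec u v (star w)

theorem outer_sub_right (u v w : Fin (m + 2) → ℂ) : outer w (u - v) = outer w u - outer w v := by
  unfold outer; rw [star_sub]; exact Matrix.vecMulVec_sub _ _ _

theorem outer_smul_left (c : ℂ) (v w : Fin (m + 2) → ℂ) : outer (c • v) w = c • outer v w :=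
  Matrix.smul_vecMulVec c v (star w)

theorem outer_smul_right (c : ℂ) (v w : Fin (m + 2) → ℂ) :
    outer w (c • v) = star c • outer w v := by
  unfold outer; rw [star_smul]; exact Matrix.vecMulVec_smul _ _ _

/-- The action of a matrix on vectors. -/
def act (X : Mat m) (v : Fin (m + 2) → ℂ) : Fin (m + 2) → ℂ := Matrix.mulVec X v

theorem mul_outer (X : Mat m) (v w : Fin (m + 2) → ℂ) : X * outer v w = outer (act X v) w :=
  Matrix.mul_vecMulVec X v (star w)

theorem outer_mul (X : Mat m) (v w : Fin (m + 2) → ℂ) :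
    outer v w * X = outer v (act (star X) w) := by
  rw [← star_star (outer v w * X), star_mul, star_outer, mul_outer, star_outer]

theorem act_outer (v w u : Fin (m + 2) → ℂ) : act (outer v w) u = (star w ⬝ᵥ u) • v := by
  refine (Matrix.vecMulVec_mulVec v (star w) u).trans ?_
  ext i; simp [mul_comm]

theorem act_add (X Y : Mat m) (v : Fin (m + 2) → ℂ) : act (X + Y) v = act X v + act Y v :=
  Matrix.add_mulVec X Y v

theorem act_sub (X Y : Mat m) (v : Fin (m + 2) → ℂ) : act (X - Y) v = act X v - act Y v :=
  Matrix.sub_mulVec X Y v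

theorem act_one (v : Fin (m + 2) → ℂ) : act (1 : Mat m) v = v := Matrix.one_mulVec v

theorem act_mul (X Y : Mat m) (u : Fin (m + 2) → ℂ) : act (X * Y) u = act X (act Y u) :=
  (Matrix.mulVec_mulVec u X Y).symm

theorem act_smul (c : ℂ) (X : Mat m) (v : Fin (m + 2) → ℂ) : act (c • X) v = c • act X v :=
  Matrix.smul_mulVec c X v

theorem metric_add_left (X Y Z : Mat m) : metric (X + Y) Z = metric X Z + metric Y Z := by
  simp [metric, add_mul, tr_add, mul_add]

theorem metric_smul_left (c : ℝ) (X Y : Mat m) : metric (c • X) Y = c * metric X Y := by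
  have : (c • X : Mat m) = (c : ℂ) • X := (Complex.coe_smul c X).symm
  rw [this, metric, metric, smul_mul_assoc, tr_smul, Complex.re_ofReal_mul]; ring

theorem metric_comm (X Y : Mat m) : metric X Y = metric Y X := by
  have : tr (Y * star X) = star (tr (X * star Y)) := by rw [← tr_star, star_mul, star_star]
  rw [metric, metric, this]; simp

/-- The metric as a bilinear form. -/
def metricForm (m : ℕ) : Mat m →ₗ[ℝ] Mat m →ₗ[ℝ] ℝ :=
  LinearMap.mk₂ ℝ metric metric_add_left metric_smul_left
    (fun X Y Z => by rw [metric_comm, metric_add_left, metric_comm Y, metric_comm Z])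
    (fun c X Y => by rw [metric_comm, metric_smul_left, metric_comm Y]; rfl)

/-- The metric as a continuous bilinear form. -/
def metricL (m : ℕ) : Mat m →L[ℝ] Mat m →L[ℝ] ℝ :=
  LinearMap.toContinuousLinearMap
    ((LinearMap.toContinuousLinearMap (𝕜 := ℝ) (E := Mat m) (F' := ℝ)).toLinearMap ∘ₗ metricForm m)

theorem metricL_apply (X Y : Mat m) : metricL m X Y = metric X Y := rfl

theorem metric_add_right (X Y Z : Mat m) : metric Z (X + Y) = metric Z X + metric Z Y :=
  (metricForm m Z).map_add X Y

theorem metric_smul_right (c : ℝ) (X Y : Mat m) : metric Y (c • X) = c * metric Y X :=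
  (metricForm m Y).map_smul c X

theorem metric_sub_right (X Y Z : Mat m) : metric Z (X - Y) = metric Z X - metric Z Y :=
  (metricForm m Z).map_sub X Y

theorem metric_sub_left (X Y Z : Mat m) : metric (X - Y) Z = metric X Z - metric Y Z := by
  rw [metric_comm, metric_sub_right, metric_comm Z, metric_comm Z]

theorem metric_neg_right (X Z : Mat m) : metric Z (-X) = -metric Z X :=
  (metricForm m Z).map_neg X

theorem metric_neg_left (X Z : Mat m) : metric (-X) Z = -metric X Z := by
  rw [metric_comm, metric_neg_right, metric_comm]

theorem metric_zero_right (Z : Mat m) : metric Z 0 = 0 := (metricForm m Z).map_zero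

theorem metric_zero_left (Z : Mat m) : metric 0 Z = 0 := by
  rw [metric_comm, metric_zero_right]

theorem metric_self_nonneg (X : Mat m) : 0 ≤ metric X X := by
  have h : tr (X * star X) = ∑ i, ∑ j, (X : Matrix _ _ ℂ) i j * star ((X : Matrix _ _ ℂ) i j) := rfl
  rw [metric, h]
  simp only [Complex.re_sum]
  refine mul_nonneg (by norm_num) (Finset.sum_nonneg fun i _ => Finset.sum_nonneg fun j _ => ?_)
  rw [Complex.star_def, Complex.mul_conj]
  exact Complex.normSq_nonneg _

theorem eq_zero_of_metric_self {X : Mat m} (hX : metric X X = 0) : X = 0 := by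
  have h : tr (X * star X) = ∑ i, ∑ j, (X : Matrix _ _ ℂ) i j * star ((X : Matrix _ _ ℂ) i j) := rfl
  rw [metric, h] at hX
  simp only [Complex.re_sum, Complex.star_def, Complex.mul_conj, Complex.ofReal_re] at hX
  have h0 := (mul_eq_zero.1 hX).resolve_left (by norm_num)
  have h0 := (Finset.sum_eq_zero_iff_of_nonneg
    (fun i _ => Finset.sum_nonneg fun j _ => Complex.normSq_nonneg _)).1 h0
  refine (Matrix.ext fun i j => ?_ : (X : Matrix _ _ ℂ) = 0)
  have h1 := (Finset.sum_eq_zero_iff_of_nonneg (fun j _ => Complex.normSq_nonneg _)).1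
    (h0 i (Finset.mem_univ i))
  exact Complex.normSq_eq_zero.1 (h1 j (Finset.mem_univ j))

/-! ### Points of the quadric and tangent vectors in terms of a unit vector -/

/-- `z` is a unit vector spanning a point of the quadric. -/
structure IsUnitIsotropic (z : Fin (m + 2) → ℂ) : Prop where
  unit : star z ⬝ᵥ z = 1
  isotropic : z ⬝ᵥ z = 0

/-- `v` is orthogonal to `z` and to its conjugate. -/
structure IsHoriz (z v : Fin (m + 2) → ℂ) : Prop where
  orth : star z ⬝ᵥ v = 0
  dot : z ⬝ᵥ v = 0

/-- The tangent vector of the quadric given by `v`. -/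
def tan (z v : Fin (m + 2) → ℂ) : Mat m := outer v z + outer z v

theorem star_dot (v w : Fin (m + 2) → ℂ) : star (v ⬝ᵥ w) = star v ⬝ᵥ star w := by
  rw [Matrix.star_dotProduct_star, dotProduct_comm]

theorem star_dot_comm (v w : Fin (m + 2) → ℂ) : star v ⬝ᵥ w = star (star w ⬝ᵥ v) := by
  rw [star_dot, star_star, dotProduct_comm]

namespace IsUnitIsotropic

variable {z : Fin (m + 2) → ℂ}

theorem unit' (hz : IsUnitIsotropic z) : z ⬝ᵥ star z = 1 := by
  rw [dotProduct_comm, hz.unit]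

theorem isotropic' (hz : IsUnitIsotropic z) : star z ⬝ᵥ star z = 0 := by
  rw [← star_dot, hz.isotropic, star_zero]

end IsUnitIsotropic

namespace IsHoriz

variable {z v w : Fin (m + 2) → ℂ}

theorem dot' (h : IsHoriz z v) : v ⬝ᵥ z = 0 := by rw [dotProduct_comm, h.dot]

theorem orth' (h : IsHoriz z v) : star v ⬝ᵥ z = 0 := by rw [star_dot_comm, h.orth, star_zero]

theorem star_dot_star (h : IsHoriz z v) : star z ⬝ᵥ star v = 0 := by
  rw [← star_dot, h.dot, star_zero]

theorem star_dot_star' (h : IsHoriz z v) : star v ⬝ᵥ star z = 0 := by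
  rw [← star_dot, h.dot', star_zero]

theorem dot_star (h : IsHoriz z v) : v ⬝ᵥ star z = 0 := by rw [dotProduct_comm, h.orth]

theorem dot_star' (h : IsHoriz z v) : z ⬝ᵥ star v = 0 := by rw [dotProduct_comm, h.orth']

theorem conj (h : IsHoriz z v) : IsHoriz z (star v) := ⟨h.star_dot_star, h.dot_star'⟩

theorem add (h : IsHoriz z v) (h' : IsHoriz z w) : IsHoriz z (v + w) :=
  ⟨by rw [dotProduct_add, h.orth, h'.orth, add_zero],
    by rw [dotProduct_add, h.dot, h'.dot, add_zero]⟩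

theorem smul (c : ℂ) (h : IsHoriz z v) : IsHoriz z (c • v) :=
  ⟨by rw [dotProduct_smul, h.orth, smul_zero], by rw [dotProduct_smul, h.dot, smul_zero]⟩

theorem sub (h : IsHoriz z v) (h' : IsHoriz z w) : IsHoriz z (v - w) :=
  ⟨by rw [dotProduct_sub, h.orth, h'.orth, sub_zero],
    by rw [dotProduct_sub, h.dot, h'.dot, sub_zero]⟩

end IsHoriz

/-- The derivative of `tangentProj` in the base point: `(π'_x) Y`. -/
def tangentProjDeriv (P x Y : Mat m) : Mat m :=
  (1 / 2 : ℂ) • (-(x + transp x) * (Y + star Y) * P + (1 - P - transp P) * (Y + star Y) * x +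
    (x * (Y + star Y) * (1 - P - transp P) - P * (Y + star Y) * (x + transp x)))

/-- The curvature tensor of the quadric, `R(x, y) w = [[x, y] - [x, y]ᵗ, w]`. -/
def curvForm (x y w : Mat m) : Mat m :=
  (x * y - y * x - transp (x * y - y * x)) * w - w * (x * y - y * x - transp (x * y - y * x))

/-- The curvature tensor of the quadric on vectors orthogonal to `z` and its conjugate. -/
def curvVec (x y w : Fin (m + 2) → ℂ) : Fin (m + 2) → ℂ :=
  (star y ⬝ᵥ w) • x - (star x ⬝ᵥ w) • y + (star y ⬝ᵥ x - star x ⬝ᵥ y) • w +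
    (y ⬝ᵥ w) • star x - (x ⬝ᵥ w) • star y

theorem half_mul_add_self (X Y Z : Mat m) : (1 / 2 : ℂ) • (X * (Y + Y) * Z) = X * Y * Z := by
  rw [← two_smul ℂ Y, mul_smul_comm, smul_mul_assoc, smul_smul]; norm_num

theorem tangentProj_of_star_eq {P X : Mat m} (hX : star X = X) :
    tangentProj P X = (1 - P - transp P) * X * P + P * X * (1 - P - transp P) := by
  rw [tangentProj, hX, smul_add, half_mul_add_self, half_mul_add_self]

theorem tangentProjDeriv_of_star_eq {P x X : Mat m} (hX : star X = X) :
    tangentProjDeriv P x X = -(x + transp x) * X * P + (1 - P - transp P) * X * x +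
    (x * X * (1 - P - transp P) - P * X * (x + transp x)) := by
  rw [tangentProjDeriv, hX, smul_add, smul_add, smul_sub]
  simp only [half_mul_add_self]

section Tan

variable {z x y w : Fin (m + 2) → ℂ}

theorem star_tan : star (tan z x) = tan z x := by
  rw [tan, star_add, star_outer, star_outer, add_comm]

theorem transp_tan : transp (tan z x) = outer (star z) (star x) + outer (star x) (star z) := by
  rw [tan, transp_add, transp_outer, transp_outer]

theorem tan_add : tan z (x + y) = tan z x + tan z y := by
  simp only [tan, outer_add_left, outer_add_right]; abel

theorem tan_smul (c : ℝ) : tan z ((c : ℂ) • x) = c • tan z x := by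
  rw [← Complex.coe_smul c (tan z x)]
  simp only [tan, outer_smul_left, outer_smul_right, Complex.star_def, Complex.conj_ofReal,
    smul_add]

theorem tan_sub : tan z (x - y) = tan z x - tan z y := by
  simp only [tan, outer_sub_left, outer_sub_right]; abel

theorem act_tan (hz : IsUnitIsotropic z) (hx : IsHoriz z x) : act (tan z x) z = x := by
  rw [tan, act_add, act_outer, act_outer, hz.unit, hx.orth', one_smul, zero_smul, add_zero]

theorem tan_injective (hz : IsUnitIsotropic z) (hx : IsHoriz z x) (hy : IsHoriz z y)
    (h : tan z x = tan z y) : x = y := by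
  rw [← act_tan hz hx, h, act_tan hz hy]

theorem metric_tan (hz : IsUnitIsotropic z) (hx : IsHoriz z x) (hy : IsHoriz z y) :
    metric (tan z x) (tan z y) = (star x ⬝ᵥ y).re := by
  have h : star y ⬝ᵥ x = star (star x ⬝ᵥ y) := star_dot_comm _ _
  rw [metric, star_tan]
  simp only [tan, add_mul, mul_add, outer_mul_outer, tr_add, tr_smul, tr_outer, hz.unit, hx.orth,
    hy.orth, hx.orth', hy.orth', h]
  simp
  ring

theorem tangentProj_tan (hz : IsUnitIsotropic z) (hx : IsHoriz z x) :
    tangentProj (outer z z) (tan z x) = tan z x := by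
  rw [tangentProj_of_star_eq star_tan, transp_outer]
  simp only [tan, add_mul, mul_add, sub_mul, mul_sub, outer_mul_outer, hz.unit, hx.orth, hx.orth',
    hx.star_dot_star', hx.dot, one_mul, mul_one, star_star, one_smul, zero_smul, smul_mul_assoc,
    mul_smul_comm, hx.dot', hz.isotropic, hx.star_dot_star, hz.isotropic',
    mul_zero, zero_mul, smul_zero]
  module

/-- Reduces curvature to vectors. In `curvVec` the first three terms are the curvature of complex
projective space; the last two come from the conjugation v ↦ v̄. -/
theorem curvForm_tan (hz : IsUnitIsotropic z) (hx : IsHoriz z x) (hy : IsHoriz z y)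
    (hw : IsHoriz z w) :
    curvForm (tan z x) (tan z y) (tan z w) = tan z (curvVec x y w) := by
  rw [curvForm, curvVec]
  simp only [transp_sub, transp_mul, transp_tan]
  simp only [tan, add_mul, mul_add, sub_mul, mul_sub, outer_mul_outer, hz.unit, hx.orth, hx.orth',
    hx.star_dot_star', hx.dot, one_mul, mul_one, star_star, one_smul, zero_smul, smul_mul_assoc,
    mul_smul_comm, hx.dot', hz.isotropic, hx.star_dot_star, hz.isotropic', hz.unit', hx.dot_star,
    hx.dot_star',
    hy.orth, hy.orth', hy.star_dot_star', hy.dot, hy.dot', hy.star_dot_star, hy.dot_star,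
    hy.dot_star', hw.orth, hw.orth', hw.star_dot_star', hw.dot, hw.dot', hw.star_dot_star,
    hw.dot_star, hw.dot_star', outer_add_left, outer_sub_left, outer_smul_left,
    outer_add_right, outer_sub_right, outer_smul_right, smul_smul, mul_zero, zero_mul, smul_zero]
  simp only [star_sub, star_dot, star_star]
  rw [dotProduct_comm y (star w), dotProduct_comm x (star w), dotProduct_comm y (star x),
    dotProduct_comm x (star y), dotProduct_comm (star y) (star w),
    dotProduct_comm (star x) (star w)]
  module

end Tan

/-! ### Second fundamental form and Gauss equation of the quadric -/

section Gauss

variable {z x y w : Fin (m + 2) → ℂ}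

/-- The second fundamental form of the quadric in the space of matrices. -/
theorem tangentProjDeriv_tan (hz : IsUnitIsotropic z) (hx : IsHoriz z x) (hy : IsHoriz z y) :
    tangentProjDeriv (outer z z) (tan z x) (tan z y) = outer y x + outer x y
      - (star x ⬝ᵥ y + star y ⬝ᵥ x) • outer z z - (x ⬝ᵥ y) • outer (star z) z
      - (star x ⬝ᵥ star y) • outer z (star z) := by
  rw [tangentProjDeriv_of_star_eq star_tan, transp_outer, transp_tan]
  simp only [tan, add_mul, mul_add, sub_mul, mul_sub, neg_mul, outer_mul_outer, hz.unit, hx.orth,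
    hx.orth', hx.star_dot_star', hx.dot, one_mul, mul_one, star_star, one_smul, zero_smul,
    smul_mul_assoc, mul_smul_comm, hx.dot', hz.isotropic, hx.star_dot_star, hz.isotropic',
    hz.unit', hx.dot_star, hx.dot_star', hy.orth, hy.orth', hy.star_dot_star', hy.dot, hy.dot',
    hy.star_dot_star, hy.dot_star, hy.dot_star', mul_zero, zero_mul, smul_zero]
  rw [dotProduct_comm (star y) (star x)]
  module

/-- The ambient space of matrices is flat, so the curvature is the tangential part of a commutator.
The inner `tangentProjDeriv` is the second fundamental form; the outer one acts on a normal matrix,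
as a Weingarten operator. -/
theorem gauss_equation (hz : IsUnitIsotropic z) (hx : IsHoriz z x) (hy : IsHoriz z y)
    (hw : IsHoriz z w) :
    tangentProj (outer z z)
      (tangentProjDeriv (outer z z) (tan z x) (tangentProjDeriv (outer z z) (tan z y) (tan z w)) -
      tangentProjDeriv (outer z z) (tan z y) (tangentProjDeriv (outer z z) (tan z x) (tan z w))) =
    curvForm (tan z x) (tan z y) (tan z w) := by
  -- The second fundamental form is Hermitian, so the symmetrization inside `tangentProjDeriv` can
  -- be dropped.
  have hs : ∀ {x y : Fin (m + 2) → ℂ}, star (outer y x + outer x y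
      - (star x ⬝ᵥ y + star y ⬝ᵥ x) • outer z z - (x ⬝ᵥ y) • outer (star z) z
      - (star x ⬝ᵥ star y) • outer z (star z)) = outer y x + outer x y
      - (star x ⬝ᵥ y + star y ⬝ᵥ x) • outer z z - (x ⬝ᵥ y) • outer (star z) z
      - (star x ⬝ᵥ star y) • outer z (star z) := by
    intro x y
    simp only [star_sub, star_add, star_smul, star_outer, star_dot, star_star]
    rw [dotProduct_comm x (star y), dotProduct_comm y (star x)]
    module
  rw [curvForm_tan hz hx hy hw, tangentProjDeriv_tan hz hy hw, tangentProjDeriv_tan hz hx hw,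
    tangentProjDeriv_of_star_eq hs, tangentProjDeriv_of_star_eq hs, transp_outer, transp_tan,
    transp_tan]
  simp only [tan, add_mul, mul_add, sub_mul, mul_sub, neg_mul, outer_mul_outer, hz.unit, hx.orth,
    hx.orth', hx.star_dot_star', hx.dot, one_mul, mul_one, star_star, one_smul, zero_smul,
    smul_mul_assoc, mul_smul_comm, hx.dot', hz.isotropic, hx.star_dot_star, hz.isotropic',
    hz.unit', hx.dot_star, hx.dot_star', hy.orth, hy.orth', hy.star_dot_star', hy.dot, hy.dot',
    hy.star_dot_star, hy.dot_star, hy.dot_star', hw.orth, hw.orth', hw.star_dot_star', hw.dot,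
    hw.dot', hw.star_dot_star, hw.dot_star, hw.dot_star', smul_add, smul_sub, mul_zero, zero_mul,
    smul_zero, neg_zero, add_zero, zero_add, sub_zero, zero_sub]
  rw [tangentProj, transp_outer]
  simp only [star_add, star_sub, star_neg, star_smul, star_outer, star_dot, star_star]
  simp only [tan, add_mul, mul_add, sub_mul, mul_sub, neg_mul, mul_neg, outer_mul_outer, hz.unit,
    hx.orth,
    hx.orth', hx.star_dot_star', hx.dot, one_mul, mul_one, star_star, one_smul, zero_smul,
    smul_mul_assoc, mul_smul_comm, hx.dot', hz.isotropic, hx.star_dot_star, hz.isotropic',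
    hz.unit', hx.dot_star, hx.dot_star', hy.orth, hy.orth', hy.star_dot_star', hy.dot, hy.dot',
    hy.star_dot_star, hy.dot_star, hy.dot_star', hw.orth, hw.orth', hw.star_dot_star', hw.dot,
    hw.dot', hw.star_dot_star, hw.dot_star, hw.dot_star', smul_add, smul_sub, mul_zero, zero_mul,
    smul_zero, neg_zero, add_zero, zero_add, sub_zero, zero_sub, curvVec, outer_add_left,
    outer_add_right, outer_sub_left, outer_sub_right, outer_smul_left, outer_smul_right,
    star_sub, star_dot]
  rw [dotProduct_comm y (star w), dotProduct_comm x (star w), dotProduct_comm w (star y),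
    dotProduct_comm w (star x), dotProduct_comm y (star x), dotProduct_comm x (star y)]
  module

end Gauss

/-- The line matrices of the points of the quadric. -/
def IsQuadricPoint (P : Mat m) : Prop := ∃ z, IsUnitIsotropic z ∧ P = outer z z

/-! ### The orthogonal projection onto the tangent space -/

theorem act_normal_complement (z u : Fin (m + 2) → ℂ) :
    act (1 - outer z z - transp (outer z z)) u =
      u - (star z ⬝ᵥ u) • z - (z ⬝ᵥ u) • star z := by
  rw [act_sub, act_sub, act_one, transp_outer, act_outer, act_outer, star_star]

theorem isHoriz_act {z : Fin (m + 2) → ℂ} (hz : IsUnitIsotropic z) (u : Fin (m + 2) → ℂ) :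
    IsHoriz z (act (1 - outer z z - transp (outer z z)) u) := by
  rw [act_normal_complement]
  constructor
  · simp [dotProduct_sub, hz.unit, hz.isotropic']
  · simp [dotProduct_sub, hz.unit', hz.isotropic]

theorem star_normal_complement (z : Fin (m + 2) → ℂ) :
    star (1 - outer z z - transp (outer z z)) = 1 - outer z z - transp (outer z z) := by
  rw [transp_outer, star_sub, star_sub, star_one, star_outer, star_outer]

/-- The vector is the component of ½(X + X*)z orthogonal to z and z̄. Through this normal form,
statements on tangent matrices become statements on vectors. -/
theorem exists_tangentProj_eq_tan {z : Fin (m + 2) → ℂ} (hz : IsUnitIsotropic z) (X : Mat m) :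
    ∃ v, IsHoriz z v ∧ tangentProj (outer z z) X = tan z v := by
  refine ⟨act (1 - outer z z - transp (outer z z)) (act ((1 / 2 : ℂ) • (X + star X)) z),
    isHoriz_act hz _, ?_⟩
  have h2 : star (1 / 2 : ℂ) = 1 / 2 := by simp
  have h1 : star (((X + star X)) * (1 - outer z z - transp (outer z z))) =
      (1 - outer z z - transp (outer z z)) * (X + star X) := by
    rw [star_mul, star_normal_complement, star_add, star_star, add_comm (star X)]
  rw [tangentProj, mul_assoc (outer z z), mul_outer, outer_mul, h1, ← act_mul, mul_smul_comm,
    act_smul, tan, outer_smul_left, outer_smul_right, h2, smul_add]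

theorem tangentProj_eq_self_iff {z : Fin (m + 2) → ℂ} (hz : IsUnitIsotropic z) {X : Mat m} :
    tangentProj (outer z z) X = X ↔ ∃ v, IsHoriz z v ∧ X = tan z v := by
  constructor
  · intro h
    rw [← h]
    exact exists_tangentProj_eq_tan hz X
  · rintro ⟨v, hv, rfl⟩
    exact tangentProj_tan hz hv

theorem IsQuadricPoint.tangentProj_tangentProj {P : Mat m} (hP : IsQuadricPoint P) (X : Mat m) :
    tangentProj P (tangentProj P X) = tangentProj P X := by
  obtain ⟨z, hz, rfl⟩ := hP
  obtain ⟨v, hv, h⟩ := exists_tangentProj_eq_tan hz X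
  rw [h, tangentProj_tan hz hv]

theorem IsQuadricPoint.star_eq {P : Mat m} (hP : IsQuadricPoint P) : star P = P := by
  obtain ⟨z, hz, rfl⟩ := hP
  exact star_outer z z

theorem tangentProj_add (P X Y : Mat m) :
    tangentProj P (X + Y) = tangentProj P X + tangentProj P Y := by
  simp only [tangentProj, star_add, ← smul_add]
  congr 1
  noncomm_ring

theorem tangentProj_smul (P X : Mat m) (c : ℝ) : tangentProj P (c • X) = c • tangentProj P X := by
  have : ∀ Y : Mat m, (c • Y : Mat m) = (c : ℂ) • Y := fun Y => (Complex.coe_smul c Y).symm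
  simp only [this, tangentProj, star_smul, Complex.star_def, Complex.conj_ofReal, ← smul_add,
    mul_smul_comm, smul_mul_assoc]
  rw [smul_comm]

/-- `tangentProj P` as a real linear map. -/
def tangentProjLin (P : Mat m) : Mat m →ₗ[ℝ] Mat m where
  toFun := tangentProj P
  map_add' := tangentProj_add P
  map_smul' c X := tangentProj_smul P X c

theorem tangentProj_sub (P X Y : Mat m) :
    tangentProj P (X - Y) = tangentProj P X - tangentProj P Y :=
  (tangentProjLin P).map_sub X Y

theorem tangentProj_zero (P : Mat m) : tangentProj P 0 = 0 := (tangentProjLin P).map_zero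

theorem re_tr_star (X : Mat m) : (tr (star X)).re = (tr X).re := by rw [tr_star]; simp

theorem metric_tangentProj {P : Mat m} (hP : IsQuadricPoint P) (X Y : Mat m) :
    metric (tangentProj P X) Y = metric X (tangentProj P Y) := by
  have hP' := hP.star_eq
  have hQ : star (1 - P - transp P) = 1 - P - transp P := by
    rw [star_sub, star_sub, star_one, star_transp, hP']
  set Q := 1 - P - transp P with hQd
  have e : ∀ A B : Mat m, (tr (A * star X * B * star Y)).re = (tr (X * star A * Y * star B)).re := by
    intro A B
    rw [← re_tr_star, star_mul, star_mul, star_mul, star_star, star_star, tr_mul_comm]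
    rw [mul_assoc, mul_assoc, mul_assoc, tr_mul_comm, mul_assoc, mul_assoc]
  have e' : ∀ A B : Mat m, (tr (A * X * B * star Y)).re = (tr (X * B * star Y * A)).re := by
    intro A B
    rw [mul_assoc, mul_assoc, tr_mul_comm]
    simp only [mul_assoc]
  have hs : star (tangentProj P Y) = tangentProj P Y := by
    obtain ⟨z, hz, rfl⟩ := hP
    obtain ⟨v, hv, h⟩ := exists_tangentProj_eq_tan hz Y
    rw [h, star_tan]
  rw [metric, metric, hs]
  simp only [tangentProj, ← hQd, smul_mul_assoc, mul_smul_comm, tr_smul, mul_add, add_mul, tr_add,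
    Complex.mul_re, Complex.add_re, e, e', hP', hQ]
  simp only [← mul_assoc]
  norm_num
  ring

/-! ### Derivatives -/

/-- The transpose as a real continuous linear map. -/
def transpL (m : ℕ) : Mat m →L[ℝ] Mat m :=
  LinearMap.toContinuousLinearMap
    { toFun := transp, map_add' := transp_add, map_smul' := fun c X => Matrix.transpose_smul c X }

/-- The conjugate transpose as a real continuous linear map. -/
def adjL (m : ℕ) : Mat m →L[ℝ] Mat m :=
  LinearMap.toContinuousLinearMap
    { toFun := star
      map_add' := star_add
      map_smul' := fun c X => by
        rw [← Complex.coe_smul c X, star_smul, Complex.star_def, Complex.conj_ofReal,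
          Complex.coe_smul]; rfl }

theorem transpL_apply (X : Mat m) : transpL m X = transp X := rfl

theorem adjL_apply (X : Mat m) : adjL m X = star X := rfl

section Calculus

variable {E : Type*} [NormedAddCommGroup E] [NormedSpace ℝ E] {P X Y : E → Mat m} {q : E}
  {n : WithTop ℕ∞}

theorem hasFDerivAt_transp {P' : E →L[ℝ] Mat m} (hP : HasFDerivAt P P' q) :
    HasFDerivAt (fun q => transp (P q)) ((transpL m).comp P') q :=
  (transpL m).hasFDerivAt.comp q hP

theorem hasFDerivAt_star {P' : E →L[ℝ] Mat m} (hP : HasFDerivAt P P' q) :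
    HasFDerivAt (fun q => star (P q)) ((adjL m).comp P') q :=
  (adjL m).hasFDerivAt.comp q hP

theorem _root_.ContDiffAt.mat_transp (hP : ContDiffAt ℝ n P q) :
    ContDiffAt ℝ n (fun q => transp (P q)) q :=
  (transpL m).contDiff.contDiffAt.comp q hP

theorem _root_.ContDiffAt.mat_star (hP : ContDiffAt ℝ n P q) :
    ContDiffAt ℝ n (fun q => star (P q)) q :=
  (adjL m).contDiff.contDiffAt.comp q hP

theorem _root_.ContDiffAt.mat_tangentProj (hP : ContDiffAt ℝ n P q) (hX : ContDiffAt ℝ n X q) :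
    ContDiffAt ℝ n (fun q => tangentProj (P q) (X q)) q := by
  unfold tangentProj
  have hQ := (contDiffAt_const (c := (1 : Mat m))).sub hP |>.sub hP.mat_transp
  have hH := hX.add hX.mat_star
  exact (contDiffAt_const (c := (1 / 2 : ℂ))).smul (((hQ.mul hH).mul hP).add ((hP.mul hH).mul hQ))

theorem _root_.ContDiffAt.metric (hX : ContDiffAt ℝ n X q) (hY : ContDiffAt ℝ n Y q) :
    ContDiffAt ℝ n (fun q => metric (X q) (Y q)) q :=
  ((metricL m).contDiff.contDiffAt.comp q hX).clm_apply hY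

theorem fderiv_metric (hX : DifferentiableAt ℝ X q) (hY : DifferentiableAt ℝ Y q) (v : E) :
    fderiv ℝ (fun q => metric (X q) (Y q)) q v =
      metric (fderiv ℝ X q v) (Y q) + metric (X q) (fderiv ℝ Y q v) := by
  have h := ((metricL m).hasFDerivAt.comp q hX.hasFDerivAt).clm_apply hY.hasFDerivAt
  refine (congrArg (fun L => L v) h.fderiv).trans ?_
  simp [metricL_apply, add_comm]

theorem fderiv_tangentProj (hP : DifferentiableAt ℝ P q) (hX : DifferentiableAt ℝ X q) (v : E) :
    fderiv ℝ (fun q => tangentProj (P q) (X q)) q v =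
      tangentProjDeriv (P q) (fderiv ℝ P q v) (X q) + tangentProj (P q) (fderiv ℝ X q v) := by
  have hQ := ((hasFDerivAt_const (1 : Mat m) q).sub hP.hasFDerivAt).sub
    (hasFDerivAt_transp hP.hasFDerivAt)
  have hH := hX.hasFDerivAt.add (hasFDerivAt_star hX.hasFDerivAt)
  have h := (((hQ.mul' hH).mul' hP.hasFDerivAt).add
    ((hP.hasFDerivAt.mul' hH).mul' hQ)).const_smul (1 / 2 : ℂ)
  refine (congrArg (fun L => L v) h.fderiv).trans ?_
  simp only [smul_apply, add_apply,
    sub_apply, ContinuousLinearMap.comp_apply, transpL_apply, adjL_apply,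
    zero_apply, tangentProjDeriv, tangentProj, ← smul_add,
    MulOpposite.smul_eq_mul_unop, smul_eq_mul, Pi.add_apply, Pi.sub_apply, Pi.mul_apply,
    MulOpposite.unop_op]
  congr 1
  noncomm_ring

end Calculus

theorem IsUnitIsotropic.ne_zero {z : Fin (m + 2) → ℂ} (hz : IsUnitIsotropic z) : z ≠ 0 := by
  rintro rfl
  simpa using hz.unit

/-- The hypotheses are the linearizations of P* = P, P² = P and PᵗP = 0, the equations satisfied by
the points of the quadric. -/
theorem exists_eq_tan_of_derivation {z : Fin (m + 2) → ℂ} (hz : IsUnitIsotropic z) {D : Mat m}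
    (hs : star D = D) (h1 : D * outer z z + outer z z * D = D)
    (h2 : transp D * outer z z + transp (outer z z) * D = 0) :
    ∃ u, IsHoriz z u ∧ D = tan z u := by
  have hD : D = tan z (act D z) := by
    conv_lhs => rw [← h1, mul_outer, outer_mul, hs]
    rfl
  set u := act D z with hu
  have h3 : act D z = u + (star u ⬝ᵥ z) • z := by
    rw [hD, tan, act_add, act_outer, act_outer, hz.unit, one_smul]
  -- The vector u is Dz by definition, and `h3` computes Dz as u plus this multiple of z.
  have h4 : (star u ⬝ᵥ z) • z = 0 := by
    rw [← hu] at h3; exact left_eq_add.1 h3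
  have h5 : star u ⬝ᵥ z = 0 := (smul_eq_zero.1 h4).resolve_right hz.ne_zero
  refine ⟨u, ⟨by rw [star_dot_comm, h5, star_zero], ?_⟩, hD⟩
  rw [hD, transp_tan, transp_outer] at h2
  have h6 := congrArg (fun X => act X z) h2
  simp only [tan, add_mul, mul_add, outer_mul_outer, star_star, hz.isotropic, act_add, act_smul,
    act_outer, hz.unit, h5, dotProduct_comm u z] at h6
  have h7 : act (0 : Mat m) z = 0 := Matrix.zero_mulVec z
  rw [h7] at h6
  have h8 : (2 * (z ⬝ᵥ u)) • star z = 0 := by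
    rw [← h6]; module
  have h9 := (smul_eq_zero.1 h8).resolve_right (by simpa using hz.ne_zero)
  simpa using h9

/-! ### The curvature tensor -/

theorem fderiv_tangentProj_const (y Q h : Mat m) :
    fderiv ℝ (fun Q : Mat m => tangentProj Q y) Q h = tangentProjDeriv Q h y := by
  have := fderiv_tangentProj (P := fun Q : Mat m => Q) (X := fun _ => y) (q := Q)
    differentiableAt_id (differentiableAt_const y) h
  simpa [tangentProj_zero] using this

theorem cov_tangentProj (x y Q : Mat m) :
    cov (fun Q => tangentProj Q x) (fun Q => tangentProj Q y) Q =
      tangentProj Q (tangentProjDeriv Q (tangentProj Q x) y) := by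
  rw [cov, fderiv_tangentProj_const]

theorem contDiffAt_id_mat {Q : Mat m} {n : WithTop ℕ∞} : ContDiffAt ℝ n (fun Q : Mat m => Q) Q :=
  contDiffAt_id

theorem _root_.ContDiffAt.mat_tangentProjDeriv {E : Type*} [NormedAddCommGroup E] [NormedSpace ℝ E]
    {P x X : E → Mat m} {q : E} {n : WithTop ℕ∞} (hP : ContDiffAt ℝ n P q)
    (hx : ContDiffAt ℝ n x q) (hX : ContDiffAt ℝ n X q) :
    ContDiffAt ℝ n (fun q => tangentProjDeriv (P q) (x q) (X q)) q := by
  unfold tangentProjDeriv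
  have hQ := (contDiffAt_const (c := (1 : Mat m))).sub hP |>.sub hP.mat_transp
  have hH := hX.add hX.mat_star
  have hS := hx.add hx.mat_transp
  exact (contDiffAt_const (c := (1 / 2 : ℂ))).smul
    ((((hS.neg.mul hH).mul hP).add ((hQ.mul hH).mul hx)).add
      (((hx.mul hH).mul hQ).sub ((hP.mul hH).mul hS)))

/-- The derivative of `tangentProjDeriv` in the base point. -/
def tangentProjDeriv₂ (h x Y : Mat m) : Mat m :=
  (1 / 2 : ℂ) • (-(x + transp x) * (Y + star Y) * h - (h + transp h) * (Y + star Y) * x -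
    (x * (Y + star Y) * (h + transp h) + h * (Y + star Y) * (x + transp x)))

/-- Symmetry of the second derivative of the projection in the base point; it makes this term cancel
in the curvature. -/
theorem tangentProjDeriv₂_comm (h x Y : Mat m) :
    tangentProjDeriv₂ h x Y = tangentProjDeriv₂ x h Y := by
  unfold tangentProjDeriv₂
  congr 1
  noncomm_ring

theorem fderiv_tangentProjDeriv {x : Mat m → Mat m} {y Q v : Mat m}
    (hx : DifferentiableAt ℝ x Q) :
    fderiv ℝ (fun Q : Mat m => tangentProjDeriv Q (x Q) y) Q v =
      tangentProjDeriv₂ v (x Q) y + tangentProjDeriv Q (fderiv ℝ x Q v) y := by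
  have hi := hasFDerivAt_id (𝕜 := ℝ) Q
  have hQ := ((hasFDerivAt_const (1 : Mat m) Q).sub hi).sub (hasFDerivAt_transp hi)
  have hH := hasFDerivAt_const (𝕜 := ℝ) (y + star y) Q
  have hS := hx.hasFDerivAt.add (hasFDerivAt_transp hx.hasFDerivAt)
  have h := ((((hS.neg.mul' hH).mul' hi).add ((hQ.mul' hH).mul' hx.hasFDerivAt)).add
      (((hx.hasFDerivAt.mul' hH).mul' hQ).sub ((hi.mul' hH).mul' hS))).const_smul (1 / 2 : ℂ)
  refine (congrArg (fun L => L v) h.fderiv).trans ?_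
  simp only [smul_apply, add_apply, neg_apply,
    sub_apply, ContinuousLinearMap.comp_apply, transpL_apply, adjL_apply,
    zero_apply, tangentProjDeriv, tangentProjDeriv₂, ← smul_add,
    MulOpposite.smul_eq_mul_unop, smul_eq_mul, Pi.add_apply, Pi.sub_apply, Pi.mul_apply,
    MulOpposite.unop_op, ContinuousLinearMap.id_apply, id, Pi.neg_apply, MulOpposite.unop_zero]
  congr 1
  noncomm_ring

theorem tangentProjDeriv_sub (P x y Y : Mat m) :
    tangentProjDeriv P (x - y) Y = tangentProjDeriv P x Y - tangentProjDeriv P y Y := by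
  simp only [tangentProjDeriv, ← smul_sub, transp_sub]
  congr 1
  noncomm_ring

/-- Write π for the projection. On the extensions Q ↦ π_Q x, the iterated covariant derivative is
the Gauss term π(π'_x π'_y w), plus π(π''(x, y)w), plus π(π'_{π'_x y} w). Antisymmetrizing kills the
π'' term, and the last one cancels against the Lie bracket π'_x y - π'_y x. -/
theorem curvature_eq {P x y w : Mat m} (hP : IsQuadricPoint P) (hx : tangentProj P x = x)
    (hy : tangentProj P y = y) (hw : tangentProj P w = w) :
    curvature P x y w = curvForm x y w := by
  have hT : ∀ {y : Mat m}, DifferentiableAt ℝ (fun Q : Mat m => tangentProj Q y) P := fun {y} =>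
    (contDiffAt_id_mat.mat_tangentProj (contDiffAt_const (c := y) (n := 1))).differentiableAt
      one_ne_zero
  have key : ∀ {x y : Mat m}, tangentProj P x = x → tangentProj P y = y →
      cov (fun Q => tangentProj Q x) (cov (fun Q => tangentProj Q y) (fun Q => tangentProj Q w)) P =
      tangentProj P (tangentProjDeriv P x (tangentProjDeriv P y w)) +
      tangentProj P (tangentProj P (tangentProjDeriv₂ x y w +
        tangentProjDeriv P (tangentProjDeriv P x y) w)) := by
    intro x y hx hy
    have h1 : cov (fun Q => tangentProj Q y) (fun Q => tangentProj Q w) =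
        fun Q => tangentProj Q (tangentProjDeriv Q (tangentProj Q y) w) :=
      funext fun Q => cov_tangentProj y w Q
    have h2 : DifferentiableAt ℝ (fun Q : Mat m => tangentProjDeriv Q (tangentProj Q y) w) P :=
      (contDiffAt_id_mat.mat_tangentProjDeriv (contDiffAt_id_mat.mat_tangentProj
        (contDiffAt_const (c := y))) (contDiffAt_const (c := w) (n := 1))).differentiableAt
        one_ne_zero
    have h3 := fderiv_tangentProj (P := fun Q : Mat m => Q) (q := P) differentiableAt_id h2 x
    simp only [fderiv_fun_id, ContinuousLinearMap.id_apply] at h3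
    rw [h1, cov, hx, h3, fderiv_tangentProjDeriv hT, fderiv_tangentProj_const, hy,
      tangentProj_add]
  have hb : VectorField.lieBracket ℝ (fun Q => tangentProj Q x) (fun Q => tangentProj Q y) P =
      tangentProjDeriv P x y - tangentProjDeriv P y x := by
    simp only [VectorField.lieBracket_eq]
    rw [fderiv_tangentProj_const, fderiv_tangentProj_const, hx, hy]
  rw [curvature, curvatureField, key hx hy, key hy hx, cov, hb, fderiv_tangentProj_const,
    tangentProjDeriv_sub, hP.tangentProj_tangentProj, hP.tangentProj_tangentProj,
    tangentProjDeriv₂_comm x y]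
  obtain ⟨z, hz, rfl⟩ := hP
  obtain ⟨u, hu, rfl⟩ := (tangentProj_eq_self_iff hz).1 hx
  obtain ⟨v, hv, rfl⟩ := (tangentProj_eq_self_iff hz).1 hy
  obtain ⟨t, ht, rfl⟩ := (tangentProj_eq_self_iff hz).1 hw
  rw [← gauss_equation hz hu hv ht]
  simp only [tangentProj_add, tangentProj_sub]
  abel

/-! ### The grading of matrices at a point of the quadric -/

/-- The matrix `X` preserves the splitting of `ℂ^{m+2}` into the plane of `P` and `transp P` and
its complement. -/
def IsEven (P X : Mat m) : Prop := X * (P + transp P) = (P + transp P) * X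

/-- The matrix `X` interchanges the plane of `P` and `transp P` and its complement. -/
def IsOdd (P X : Mat m) : Prop := X * (P + transp P) + (P + transp P) * X = X

section Grading

variable {P X Y : Mat m}

theorem transp_add_transp : transp (P + transp P) = P + transp P := by
  rw [transp_add, transp_transp, add_comm]

theorem IsEven.transp (h : IsEven P X) : IsEven P (transp X) := by
  have := congrArg ComplexQuadric.transp h
  rw [transp_mul, transp_mul, transp_add_transp] at this
  exact this.symm

theorem IsOdd.transp (h : IsOdd P X) : IsOdd P (transp X) := by
  have := congrArg ComplexQuadric.transp h
  rw [transp_add, transp_mul, transp_mul, transp_add_transp, add_comm] at this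
  exact this

theorem IsEven.sub (hX : IsEven P X) (hY : IsEven P Y) : IsEven P (X - Y) := by
  unfold IsEven at *; rw [sub_mul, mul_sub, hX, hY]

theorem IsEven.add (hX : IsEven P X) (hY : IsEven P Y) : IsEven P (X + Y) := by
  unfold IsEven at *; rw [add_mul X Y, mul_add _ X Y, hX, hY]

theorem IsEven.neg (hX : IsEven P X) : IsEven P (-X) := by
  unfold IsEven at *; rw [neg_mul, mul_neg, hX]

theorem IsOdd.sub (hX : IsOdd P X) (hY : IsOdd P Y) : IsOdd P (X - Y) := by
  unfold IsOdd at *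
  conv_rhs => rw [← hX, ← hY]
  noncomm_ring

theorem IsOdd.add (hX : IsOdd P X) (hY : IsOdd P Y) : IsOdd P (X + Y) := by
  unfold IsOdd at *
  conv_rhs => rw [← hX, ← hY]
  noncomm_ring

theorem IsEven.mul (hX : IsEven P X) (hY : IsEven P Y) : IsEven P (X * Y) := by
  unfold IsEven at *; rw [mul_assoc, hY, ← mul_assoc, hX, mul_assoc]

theorem IsOdd.mul_even (hX : IsOdd P X) (hY : IsEven P Y) : IsOdd P (X * Y) := by
  unfold IsOdd IsEven at *
  rw [mul_assoc, hY, ← mul_assoc, ← mul_assoc, ← add_mul, hX]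

theorem IsEven.mul_odd (hX : IsEven P X) (hY : IsOdd P Y) : IsOdd P (X * Y) := by
  unfold IsOdd IsEven at *
  rw [← mul_assoc, ← hX, mul_assoc, mul_assoc, ← mul_add, hY]

theorem IsOdd.mul (hX : IsOdd P X) (hY : IsOdd P Y) : IsEven P (X * Y) := by
  unfold IsOdd IsEven at *
  rw [mul_assoc, ← mul_assoc _ X Y, eq_sub_of_add_eq hY, eq_sub_of_add_eq' hX]
  noncomm_ring

end Grading

theorem isEven_outer {z : Fin (m + 2) → ℂ} (hz : IsUnitIsotropic z) :
    IsEven (outer z z) (outer z z) := by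
  rw [IsEven, transp_outer]
  simp [mul_add, add_mul, outer_mul_outer, hz.isotropic, hz.isotropic']

/-- The projection only sees blocks between the line of `P` and the complement of the plane, and an
even matrix has none. -/
theorem IsEven.tangentProj_eq_zero {P X : Mat m} (hP : IsQuadricPoint P) (hX : IsEven P X) :
    tangentProj P X = 0 := by
  obtain ⟨z, hz, rfl⟩ := hP
  have hS : star (outer z z + ComplexQuadric.transp (outer z z)) =
      outer z z + ComplexQuadric.transp (outer z z) := by
    rw [transp_outer, star_add, star_outer, star_outer]
  have hX' : IsEven (outer z z) (star X) := by
    have := congrArg star hX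
    rw [star_mul, star_mul, hS] at this
    exact this.symm
  have h := hX.add hX'
  have hP1 : (outer z z + ComplexQuadric.transp (outer z z)) * outer z z = outer z z := by
    simp [transp_outer, add_mul, outer_mul_outer, hz.isotropic, hz.unit]
  have hP2 : outer z z * (outer z z + ComplexQuadric.transp (outer z z)) = outer z z := by
    rw [show _ = _ from isEven_outer hz, hP1]
  unfold IsEven at h
  rw [tangentProj, sub_sub, sub_mul, sub_mul, mul_sub, one_mul, mul_one, ← h, mul_assoc _ _ (outer z z),
    hP1, mul_assoc _ _ (_ + _), h, ← mul_assoc, hP2]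
  simp

theorem IsQuadricPoint.isEven {P : Mat m} (hP : IsQuadricPoint P) : IsEven P P := by
  obtain ⟨z, hz, rfl⟩ := hP
  exact isEven_outer hz

theorem isOdd_tan {z v : Fin (m + 2) → ℂ} (hz : IsUnitIsotropic z) (hv : IsHoriz z v) :
    IsOdd (outer z z) (tan z v) := by
  rw [IsOdd, transp_outer]
  simp only [tan, mul_add, add_mul, outer_mul_outer, hz.isotropic, hz.isotropic', hz.unit,
    hv.orth, hv.orth', hv.star_dot_star, hv.star_dot_star', hv.dot, hz.unit', star_star]
  module

theorem isOdd_of_tangent {P X : Mat m} (hP : IsQuadricPoint P) (hX : tangentProj P X = X) :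
    IsOdd P X := by
  obtain ⟨z, hz, rfl⟩ := hP
  obtain ⟨v, hv, rfl⟩ := (tangentProj_eq_self_iff hz).1 hX
  exact isOdd_tan hz hv

theorem isEven_one (P : Mat m) : IsEven P 1 := by rw [IsEven, one_mul, mul_one]

theorem IsQuadricPoint.star_tangentProj {P : Mat m} (hP : IsQuadricPoint P) (X : Mat m) :
    star (tangentProj P X) = tangentProj P X := by
  obtain ⟨z, hz, rfl⟩ := hP
  obtain ⟨v, hv, h⟩ := exists_tangentProj_eq_tan hz X
  rw [h, star_tan]

/-- Parity count: `P` is even, `x` and `Y` are odd, and each term contains two odd factors. With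
`IsEven.tangentProj_eq_zero`, this lets the normal part of a derivative be discarded. -/
theorem isEven_tangentProjDeriv {P x Y : Mat m} (hP : IsQuadricPoint P)
    (hx : tangentProj P x = x) (hY : tangentProj P Y = Y) :
    IsEven P (tangentProjDeriv P x Y) := by
  have hs : star Y = Y := by rw [← hY, hP.star_tangentProj]
  have hx' := isOdd_of_tangent hP hx
  have hY' := isOdd_of_tangent hP hY
  have hQ := ((isEven_one P).sub hP.isEven).sub hP.isEven.transp
  rw [tangentProjDeriv_of_star_eq hs, neg_mul, neg_mul]
  exact ((((hx'.add hx'.transp).mul hY').mul hP.isEven).neg.add ((hQ.mul_odd hY').mul hx')).add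
    (((hx'.mul hY').mul hQ).sub ((hP.isEven.mul_odd hY').mul (hx'.add hx'.transp)))

/-! ### The algebraic consequence of `𝒞`-parallelism -/

theorem star_dot_self (v : Fin (m + 2) → ℂ) :
    star v ⬝ᵥ v = ((∑ i, Complex.normSq (v i) : ℝ) : ℂ) := by
  simp [dotProduct, Complex.normSq_eq_conj_mul_self]

theorem norm_dot_self_le (v : Fin (m + 2) → ℂ) : ‖v ⬝ᵥ v‖ ≤ (star v ⬝ᵥ v).re := by
  rw [star_dot_self, Complex.ofReal_re]
  refine (norm_sum_le _ _).trans (Finset.sum_le_sum fun i _ => ?_)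
  rw [norm_mul, Complex.normSq_eq_norm_sq, sq]

theorem eq_zero_of_star_dot_self {v : Fin (m + 2) → ℂ} (h : (star v ⬝ᵥ v).re = 0) : v = 0 := by
  rw [star_dot_self, Complex.ofReal_re,
    Finset.sum_eq_zero_iff_of_nonneg (fun i _ => Complex.normSq_nonneg _)] at h
  exact funext fun i => Complex.normSq_eq_zero.1 (h i (Finset.mem_univ i))

/-- Four complex linear equations in m + 2 ≥ 5 unknowns. The full strength of 3 ≤ m is needed only
here. -/
theorem exists_horiz_orthogonal (hm : 3 ≤ m) (z n : Fin (m + 2) → ℂ) :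
    ∃ y, y ≠ 0 ∧ IsHoriz z y ∧ star n ⬝ᵥ y = 0 ∧ n ⬝ᵥ y = 0 := by
  have h := LinearMap.ker_ne_bot_of_finrank_lt (K := ℂ)
    (f := (Matrix.of ![star z, z, star n, n]).mulVecLin) (by simp; omega)
  obtain ⟨y, hy, hy0⟩ := (Submodule.ne_bot_iff _).1 h
  have hy' : ∀ i, (Matrix.of ![star z, z, star n, n]) i ⬝ᵥ y = 0 := fun i => congrFun hy i
  exact ⟨y, hy0, ⟨hy' 0, hy' 1⟩, hy' 2, hy' 3⟩

/-- Two choices of y suffice: the first removes the product w·n, the second leaves an inequality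
that only w = 0 satisfies. -/
theorem eq_zero_of_curvVec (hm : 3 ≤ m) {z n w : Fin (m + 2) → ℂ} (hn : IsHoriz z n)
    (hn1 : star n ⬝ᵥ n = 1) (hnw : star n ⬝ᵥ w = 0)
    (H : ∀ y, IsHoriz z y → (star n ⬝ᵥ y).re = 0 →
      ∃ r : ℝ, curvVec y w n + curvVec y n w = (r : ℂ) • n) : w = 0 := by
  have hwn : star w ⬝ᵥ n = 0 := by rw [star_dot_comm, hnw, star_zero]
  have h1 : w ⬝ᵥ n = 0 := by
    -- For y orthogonal to n and n̄, the bilinear product of y with the identity leaves only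
    -- 2(w·n)|y|² = 0.
    obtain ⟨y, hy0, hy, hny, hny'⟩ := exists_horiz_orthogonal hm z n
    obtain ⟨r, hr⟩ := H y hy (by simp [hny])
    have h := congrArg (fun u => y ⬝ᵥ u) hr
    have hyn : star y ⬝ᵥ n = 0 := by rw [star_dot_comm, hny, star_zero]
    have hyn' : y ⬝ᵥ n = 0 := by rw [dotProduct_comm, hny']
    have hyn'' : y ⬝ᵥ star n = 0 := by rw [dotProduct_comm, hny]
    simp only [curvVec, hnw, hwn, hny, hyn, hyn', hyn'', dotProduct_add, dotProduct_sub,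
      dotProduct_smul, smul_eq_mul, dotProduct_comm n w] at h
    have h2 : (w ⬝ᵥ n) * (y ⬝ᵥ star y) = 0 := by linear_combination h / 2
    refine (mul_eq_zero.1 h2).resolve_right fun h3 => hy0 (eq_zero_of_star_dot_self ?_)
    rw [dotProduct_comm, h3, Complex.zero_re]
  -- The Reeb direction. The Hermitian product with w gives 3|w|² = (n·n) times the conjugate of
  -- w·w, whose modulus is at most |w|².
  obtain ⟨r, hr⟩ := H ((-Complex.I) • n) (hn.smul _) (by simp [hn1])
  have h := congrArg (fun u => star w ⬝ᵥ u) hr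
  simp only [curvVec, hnw, hwn, h1, hn1, dotProduct_add, dotProduct_sub, dotProduct_smul,
    smul_dotProduct, smul_eq_mul, dotProduct_comm n w, star_smul, star_neg, Complex.star_def,
    Complex.conj_I] at h
  have h2 : 3 * (star w ⬝ᵥ w) = (n ⬝ᵥ n) * star (w ⬝ᵥ w) := by
    rw [star_dot]
    linear_combination Complex.I * h + (3 * (star w ⬝ᵥ w) - (n ⬝ᵥ n) * (star w ⬝ᵥ star w)) *
      Complex.I_mul_I
  have h3 := congrArg norm h2
  rw [norm_mul, norm_mul, norm_star] at h3
  have h4 := norm_dot_self_le n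
  have h5 := norm_dot_self_le w
  have h6 := Complex.re_le_norm (star w ⬝ᵥ w)
  rw [hn1, Complex.one_re] at h4
  have h7 := mul_le_mul h4 h5 (norm_nonneg _) zero_le_one
  have h8 : ‖(3 : ℂ)‖ = 3 := by norm_num
  rw [h8] at h3
  apply eq_zero_of_star_dot_self
  have h9 : 0 ≤ (star w ⬝ᵥ w).re := (norm_nonneg _).trans h5
  linarith

/-! ### Properties of the curvature form -/

theorem curvForm_add₁ (x x' y w : Mat m) :
    curvForm (x + x') y w = curvForm x y w + curvForm x' y w := by
  simp only [curvForm, transp_sub, transp_mul, transp_add]; noncomm_ring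

theorem curvForm_add₂ (x y y' w : Mat m) :
    curvForm x (y + y') w = curvForm x y w + curvForm x y' w := by
  simp only [curvForm, transp_sub, transp_mul, transp_add]; noncomm_ring

theorem curvForm_add₃ (x y w w' : Mat m) :
    curvForm x y (w + w') = curvForm x y w + curvForm x y w' := by
  simp only [curvForm]; noncomm_ring

/-- By antisymmetry, the normal correction in the connection of the hypersurface does not affect
R(·, N)N. -/
theorem curvForm_sub_smul (x y w : Mat m) (c : ℝ) :
    curvForm (x - c • y) y w = curvForm x y w := by
  have h : (x - c • y) * y - y * (x - c • y) = x * y - y * x := by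
    rw [sub_mul, mul_sub, smul_mul_assoc, mul_smul_comm]; abel
  rw [curvForm, curvForm, h]

section Grading

variable {P x y w : Mat m}

theorem isEven_curvForm_of_even_left (hx : IsEven P x) (hy : IsOdd P y) (hw : IsOdd P w) :
    IsEven P (curvForm x y w) := by
  have h := (hx.mul_odd hy).sub (hy.mul_even hx)
  exact ((h.sub h.transp).mul hw).sub (hw.mul (h.sub h.transp))

theorem isEven_curvForm_of_even_middle (hx : IsOdd P x) (hy : IsEven P y) (hw : IsOdd P w) :
    IsEven P (curvForm x y w) := by
  have h := (hx.mul_even hy).sub (hy.mul_odd hx)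
  exact ((h.sub h.transp).mul hw).sub (hw.mul (h.sub h.transp))

theorem isEven_curvForm_of_even_right (hx : IsOdd P x) (hy : IsOdd P y) (hw : IsEven P w) :
    IsEven P (curvForm x y w) := by
  have h := (hx.mul hy).sub (hy.mul hx)
  exact ((h.sub h.transp).mul hw).sub (hw.mul (h.sub h.transp))

theorem tangentProj_curvForm (hP : IsQuadricPoint P) (hx : tangentProj P x = x)
    (hy : tangentProj P y = y) (hw : tangentProj P w = w) :
    tangentProj P (curvForm x y w) = curvForm x y w := by
  obtain ⟨z, hz, rfl⟩ := hP
  obtain ⟨u, hu, rfl⟩ := (tangentProj_eq_self_iff hz).1 hx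
  obtain ⟨v, hv, rfl⟩ := (tangentProj_eq_self_iff hz).1 hy
  obtain ⟨t, ht, rfl⟩ := (tangentProj_eq_self_iff hz).1 hw
  rw [curvForm_tan hz hu hv ht]
  refine tangentProj_tan hz ?_
  exact ((((hu.smul _).sub (hv.smul _)).add (ht.smul _)).add (hu.conj.smul _)).sub
    (hv.conj.smul _)

end Grading

/-! ### Differentiation along maps into the quadric -/

section

variable {E : Type*} [NormedAddCommGroup E] [NormedSpace ℝ E]

/-- Three Leibniz terms and nothing else, since the curvature formula does not involve the base
point: this is where local symmetry enters. -/
theorem fderiv_curvForm {X Y W : E → Mat m} {q : E} (hX : DifferentiableAt ℝ X q)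
    (hY : DifferentiableAt ℝ Y q) (hW : DifferentiableAt ℝ W q) (v : E) :
    fderiv ℝ (fun q => curvForm (X q) (Y q) (W q)) q v =
      curvForm (fderiv ℝ X q v) (Y q) (W q) + curvForm (X q) (fderiv ℝ Y q v) (W q) +
        curvForm (X q) (Y q) (fderiv ℝ W q v) := by
  have hB := (hX.hasFDerivAt.mul' hY.hasFDerivAt).sub (hY.hasFDerivAt.mul' hX.hasFDerivAt)
  have hK := hB.sub (hasFDerivAt_transp hB)
  have h := (hK.mul' hW.hasFDerivAt).sub (hW.hasFDerivAt.mul' hK)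
  refine (congrArg (fun L : E →L[ℝ] Mat m => L v) h.fderiv).trans ?_
  simp only [smul_apply, add_apply, sub_apply, ContinuousLinearMap.comp_apply, transpL_apply,
    curvForm, MulOpposite.smul_eq_mul_unop, smul_eq_mul, Pi.add_apply, Pi.sub_apply, Pi.mul_apply,
    MulOpposite.unop_op, transp_sub, transp_mul, transp_add]
  noncomm_ring

/-- The derivative of a field `Y` of tangent vectors of the quadric along `P` is the sum of its
normal part `(π'_{dP}) Y` and its tangential part. -/
theorem fderiv_tangent_field {P Y : E → Mat m} {q : E} (hP : DifferentiableAt ℝ P q)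
    (hY : DifferentiableAt ℝ Y q) (hT : ∀ᶠ q' in nhds q, tangentProj (P q') (Y q') = Y q') (v : E) :
    fderiv ℝ Y q v =
      tangentProjDeriv (P q) (fderiv ℝ P q v) (Y q) + tangentProj (P q) (fderiv ℝ Y q v) := by
  rw [← fderiv_tangentProj hP hY]
  exact congrArg (fun L : E →L[ℝ] Mat m => L v) (Filter.EventuallyEq.fderiv_eq hT).symm

/-- Differentiates P* = P, P² = P and PᵗP = 0, then applies `exists_eq_tan_of_derivation`. -/
theorem tangentProj_fderiv_base {P : E → Mat m} {q : E} (hP : DifferentiableAt ℝ P q)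
    (hQ : ∀ᶠ q' in nhds q, IsQuadricPoint (P q')) (v : E) :
    tangentProj (P q) (fderiv ℝ P q v) = fderiv ℝ P q v := by
  have e1 : P =ᶠ[nhds q] fun q' => star (P q') := by
    filter_upwards [hQ] with q' h
    exact h.star_eq.symm
  have e2 : P =ᶠ[nhds q] fun q' => P q' * P q' := by
    filter_upwards [hQ] with q' h
    obtain ⟨z, hz, h⟩ := h
    rw [h, outer_mul_outer, hz.unit, one_smul]
  have e3 : (fun q' => transp (P q') * P q') =ᶠ[nhds q] fun _ => 0 := by
    filter_upwards [hQ] with q' h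
    obtain ⟨z, hz, h⟩ := h
    rw [h, transp_outer, outer_mul_outer, star_star, hz.isotropic, zero_smul]
  have d1 : star (fderiv ℝ P q v) = fderiv ℝ P q v := by
    conv_rhs => rw [e1.fderiv_eq, (hasFDerivAt_star hP.hasFDerivAt).fderiv]
    rfl
  have d2 : fderiv ℝ P q v * P q + P q * fderiv ℝ P q v = fderiv ℝ P q v := by
    have h' := congrArg (fun L : E →L[ℝ] Mat m => L v)
      (e2.fderiv_eq.trans (hP.hasFDerivAt.mul' hP.hasFDerivAt).fderiv)
    refine Eq.trans ?_ h'.symm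
    simp [add_comm]
  have d3 : transp (fderiv ℝ P q v) * P q + transp (P q) * fderiv ℝ P q v = 0 := by
    have h := congrArg (fun L : E →L[ℝ] Mat m => L v) e3.fderiv_eq
    have h' := ((hasFDerivAt_transp hP.hasFDerivAt).mul' hP.hasFDerivAt).fderiv
    rw [fderiv_const_apply] at h
    rw [← show _ = (0 : Mat m) from h]
    refine Eq.trans ?_ (congrArg (fun L : E →L[ℝ] Mat m => L v) h').symm
    simp [add_comm, transpL_apply]
  obtain ⟨z, hz, hPz⟩ := hQ.self_of_nhds
  rw [hPz] at d2 d3 ⊢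
  obtain ⟨u, hu, h⟩ := exists_eq_tan_of_derivation hz d1 d2 d3
  rw [h, tangentProj_tan hz hu]

end

/-! ### Parametrized hypersurfaces: the shape operator and the contradiction -/

section

variable {E : Type*} [NormedAddCommGroup E] [NormedSpace ℝ E]

/-- A hypersurface `P` of the quadric, parametrized by an open set `O`, with unit normal `N`. -/
structure IsHypersurfacePatch (O : Set E) (P N : E → Mat m) : Prop where
  isOpen : IsOpen O
  quadric : ∀ q ∈ O, IsQuadricPoint (P q)
  contDiffOn : ContDiffOn ℝ ∞ P O
  contDiffOn_normal : ContDiffOn ℝ ∞ N O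
  tangent : ∀ q ∈ O, tangentProj (P q) (N q) = N q
  unit : ∀ q ∈ O, metric (N q) (N q) = 1
  normal : ∀ q ∈ O, ∀ v, metric (N q) (fderiv ℝ P q v) = 0
  range : ∀ q ∈ O, ∀ T, tangentProj (P q) T = T → metric T (N q) = 0 → ∃ v, fderiv ℝ P q v = T

/-- The Reeb vector `-J N` at the point `P`. -/
def reebVec (P N : Mat m) : Mat m := -complexStructure P N

/-- The Reeb vector of a patch is principal at every point. -/
def IsHopfPatch (O : Set E) (P N : E → Mat m) : Prop :=
  ∀ q ∈ O, ∃ (v : E) (α : ℝ), fderiv ℝ P q v = reebVec (P q) (N q) ∧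
    -tangentProj (P q) (fderiv ℝ N q v) = α • reebVec (P q) (N q)

/-- The normal Jacobi operator of a patch is `𝒞`-parallel. -/
def IsCParallelPatch (O : Set E) (P N : E → Mat m) : Prop :=
  ∀ Y : E → Mat m, ContDiffOn ℝ ∞ Y O → (∀ q ∈ O, tangentProj (P q) (Y q) = Y q) →
    (∀ q ∈ O, metric (Y q) (N q) = 0) →
    ∀ q ∈ O, ∀ v, metric (fderiv ℝ P q v) (reebVec (P q) (N q)) = 0 →
      tangentProj (P q) (fderiv ℝ (fun q' => curvForm (Y q') (N q') (N q')) q v) -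
        metric (tangentProj (P q) (fderiv ℝ (fun q' => curvForm (Y q') (N q') (N q')) q v)) (N q) •
          N q - curvForm (tangentProj (P q) (fderiv ℝ Y q v) -
            metric (tangentProj (P q) (fderiv ℝ Y q v)) (N q) • N q) (N q) (N q) = 0

theorem reebVec_tan {z n : Fin (m + 2) → ℂ} (hz : IsUnitIsotropic z) (hn : IsHoriz z n) :
    reebVec (outer z z) (tan z n) = tan z (-Complex.I • n) := by
  rw [reebVec, complexStructure]
  simp only [tan, add_mul, mul_add, outer_mul_outer, hz.unit, hn.orth, hn.orth', outer_smul_left,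
    outer_smul_right, star_neg, Complex.star_def, Complex.conj_I]
  module

theorem tangentProj_reebVec {P N : Mat m} (hP : IsQuadricPoint P) (hN : tangentProj P N = N) :
    tangentProj P (reebVec P N) = reebVec P N := by
  obtain ⟨z, hz, rfl⟩ := hP
  obtain ⟨n, hn, rfl⟩ := (tangentProj_eq_self_iff hz).1 hN
  rw [reebVec_tan hz hn, tangentProj_tan hz (hn.smul _)]

theorem metric_reebVec {P N : Mat m} (hP : IsQuadricPoint P) (hN : tangentProj P N = N) :
    metric (reebVec P N) N = 0 ∧ metric (reebVec P N) (reebVec P N) = metric N N := by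
  obtain ⟨z, hz, rfl⟩ := hP
  obtain ⟨n, hn, rfl⟩ := (tangentProj_eq_self_iff hz).1 hN
  have him : (star n ⬝ᵥ n).im = 0 := by rw [star_dot_self, Complex.ofReal_im]
  rw [reebVec_tan hz hn, metric_tan hz (hn.smul _) hn, metric_tan hz (hn.smul _) (hn.smul _),
    metric_tan hz hn hn]
  have hs : star (-Complex.I • n) = Complex.I • star n := by
    rw [star_smul, star_neg, Complex.star_def, Complex.conj_I, neg_neg]
  rw [hs]
  constructor <;> simp [smul_dotProduct, him]

theorem eq_zero_of_curvForm (hm : 3 ≤ m) {P N W : Mat m} (hP : IsQuadricPoint P)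
    (hN : tangentProj P N = N) (hW : tangentProj P W = W) (hu : metric N N = 1)
    (h2 : metric W N = 0) (h1 : metric W (reebVec P N) = 0)
    (key : ∀ Y, tangentProj P Y = Y → metric Y N = 0 →
      ∃ r : ℝ, curvForm Y W N + curvForm Y N W = r • N) : W = 0 := by
  obtain ⟨z, hz, rfl⟩ := hP
  obtain ⟨n, hn, rfl⟩ := (tangentProj_eq_self_iff hz).1 hN
  obtain ⟨w, hw, rfl⟩ := (tangentProj_eq_self_iff hz).1 hW
  rw [reebVec_tan hz hn, metric_tan hz hw (hn.smul _)] at h1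
  rw [metric_tan hz hw hn] at h2
  rw [metric_tan hz hn hn] at hu
  have hn1 : star n ⬝ᵥ n = 1 := by
    rw [star_dot_self] at hu ⊢
    rw [Complex.ofReal_re] at hu
    rw [hu, Complex.ofReal_one]
  -- Orthogonality to N is the real part of this equation, orthogonality to -JN the imaginary part.
  have hwn : star w ⬝ᵥ n = 0 := by
    apply Complex.ext
    · exact h2
    · simpa [dotProduct_smul] using h1
  have hw0 : w = 0 := by
    refine eq_zero_of_curvVec hm hn hn1 (by rw [star_dot_comm, hwn, star_zero]) fun y hy hyn => ?_
    obtain ⟨r, hr⟩ := key _ (tangentProj_tan hz hy) (by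
      rw [metric_tan hz hy hn, star_dot_comm]; simpa using hyn)
    refine ⟨r, ?_⟩
    rw [curvForm_tan hz hy hw hn, curvForm_tan hz hy hn hw, ← tan_add, ← tan_smul] at hr
    have hh : ∀ {a b c : Fin (m + 2) → ℂ}, IsHoriz z a → IsHoriz z b → IsHoriz z c →
        IsHoriz z (curvVec a b c) := fun ha hb hc =>
      ((((ha.smul _).sub (hb.smul _)).add (hc.smul _)).add (ha.conj.smul _)).sub
        (hb.conj.smul _)
    exact tan_injective hz ((hh hy hw hn).add (hh hy hn hw)) (hn.smul _) hr
  rw [hw0, ← sub_self (0 : Fin (m + 2) → ℂ), tan_sub, sub_self]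

theorem fderiv_reebVec {P N : E → Mat m} {q : E} (hP : DifferentiableAt ℝ P q)
    (hN : DifferentiableAt ℝ N q) (v : E) :
    fderiv ℝ (fun q => reebVec (P q) (N q)) q v =
      -(Complex.I • (fderiv ℝ N q v * P q + N q * fderiv ℝ P q v -
        (fderiv ℝ P q v * N q + P q * fderiv ℝ N q v))) := by
  have h := (((hN.hasFDerivAt.mul' hP.hasFDerivAt).sub
    (hP.hasFDerivAt.mul' hN.hasFDerivAt)).const_smul Complex.I).neg
  refine (congrArg (fun L : E →L[ℝ] Mat m => L v) h.fderiv).trans ?_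
  simp only [neg_apply, smul_apply, add_apply, sub_apply, MulOpposite.smul_eq_mul_unop,
    smul_eq_mul, MulOpposite.unop_op]
  congr 2
  abel

theorem _root_.ContDiffAt.reebVec {P N : E → Mat m} {q : E} {n : WithTop ℕ∞}
    (hP : ContDiffAt ℝ n P q) (hN : ContDiffAt ℝ n N q) :
    ContDiffAt ℝ n (fun q => reebVec (P q) (N q)) q :=
  (contDiffAt_const (c := Complex.I)).smul ((hN.mul hP).sub (hP.mul hN)) |>.neg

theorem contDiffAt_fderiv_apply {X : E → Mat m} {q : E} (hX : ContDiffAt ℝ ∞ X q) (w : E) :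
    ContDiffAt ℝ ∞ (fun q' => fderiv ℝ X q' w) q :=
  ((hX.fderiv_right (m := ∞) (by simp)).clm_apply contDiffAt_const)

theorem fderiv_fderiv_comm {X : E → Mat m} {q : E} (hX : ContDiffAt ℝ ∞ X q) (v w : E) :
    fderiv ℝ (fun q' => fderiv ℝ X q' w) q v = fderiv ℝ (fun q' => fderiv ℝ X q' v) q w := by
  have hd : DifferentiableAt ℝ (fderiv ℝ X) q :=
    (hX.fderiv_right (m := ∞) (by simp)).differentiableAt (by simp)
  have hs : IsSymmSndFDerivAt ℝ X q := hX.isSymmSndFDerivAt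
    (by rw [minSmoothness_of_isRCLikeNormedField]; exact WithTop.coe_le_coe.2 le_top)
  have key : ∀ v w : E, fderiv ℝ (fun q' => fderiv ℝ X q' w) q v =
      fderiv ℝ (fderiv ℝ X) q v w := by
    intro v w
    have h1 := (hd.hasFDerivAt.clm_apply (hasFDerivAt_const w q)).fderiv
    rw [h1]
    simp
  rw [key, key]
  exact hs.eq v w

namespace IsHypersurfacePatch

variable {O : Set E} {P N : E → Mat m} (h : IsHypersurfacePatch O P N) {q : E}
include h

theorem contDiffAt (hq : q ∈ O) : ContDiffAt ℝ ∞ P q :=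
  h.contDiffOn.contDiffAt (h.isOpen.mem_nhds hq)

theorem contDiffAt_normal (hq : q ∈ O) : ContDiffAt ℝ ∞ N q :=
  h.contDiffOn_normal.contDiffAt (h.isOpen.mem_nhds hq)

theorem differentiableAt (hq : q ∈ O) : DifferentiableAt ℝ P q :=
  (h.contDiffAt hq).differentiableAt (by simp)

theorem differentiableAt_normal (hq : q ∈ O) : DifferentiableAt ℝ N q :=
  (h.contDiffAt_normal hq).differentiableAt (by simp)

theorem tangentProj_fderiv (hq : q ∈ O) (v : E) :
    tangentProj (P q) (fderiv ℝ P q v) = fderiv ℝ P q v :=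
  tangentProj_fderiv_base (h.differentiableAt hq)
    (Filter.eventually_of_mem (h.isOpen.mem_nhds hq) h.quadric) v

theorem fderiv_field {Y : E → Mat m} (hq : q ∈ O) (hY : DifferentiableAt ℝ Y q)
    (hT : ∀ q ∈ O, tangentProj (P q) (Y q) = Y q) (v : E) :
    fderiv ℝ Y q v =
      tangentProjDeriv (P q) (fderiv ℝ P q v) (Y q) + tangentProj (P q) (fderiv ℝ Y q v) :=
  fderiv_tangent_field (h.differentiableAt hq) hY
    (Filter.eventually_of_mem (h.isOpen.mem_nhds hq) hT) v

theorem metric_fderiv_normal_self (hq : q ∈ O) (v : E) : metric (fderiv ℝ N q v) (N q) = 0 := by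
  have e : (fun q' => metric (N q') (N q')) =ᶠ[nhds q] fun _ => 1 :=
    Filter.eventually_of_mem (h.isOpen.mem_nhds hq) h.unit
  have h1 := congrArg (fun L : E →L[ℝ] ℝ => L v) e.fderiv_eq
  have h2 := fderiv_metric (h.differentiableAt_normal hq) (h.differentiableAt_normal hq) v
  rw [fderiv_const_apply] at h1
  have h3 := h2.symm.trans h1
  rw [metric_comm (N q)] at h3
  simpa using h3

/-- The shape operator is symmetric. -/
theorem metric_fderiv_normal_comm (hq : q ∈ O) (v w : E) :
    metric (fderiv ℝ N q v) (fderiv ℝ P q w) = metric (fderiv ℝ N q w) (fderiv ℝ P q v) := by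
  have key : ∀ v w : E, metric (fderiv ℝ N q v) (fderiv ℝ P q w) +
      metric (N q) (fderiv ℝ (fun q' => fderiv ℝ P q' w) q v) = 0 := by
    intro v w
    have e : (fun q' => metric (N q') (fderiv ℝ P q' w)) =ᶠ[nhds q] fun _ => 0 :=
      Filter.eventually_of_mem (h.isOpen.mem_nhds hq) fun q hq => h.normal q hq w
    have h1 := congrArg (fun L : E →L[ℝ] ℝ => L v) e.fderiv_eq
    have h2 := fderiv_metric (h.differentiableAt_normal hq)
      ((contDiffAt_fderiv_apply (h.contDiffAt hq) w).differentiableAt (by simp)) v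
    rw [fderiv_const_apply] at h1
    exact h2.symm.trans h1
  have h1 := key v w
  have h2 := key w v
  rw [fderiv_fderiv_comm (h.contDiffAt hq) w v] at h2
  linarith

theorem metric_tangentProj_fderiv (hq : q ∈ O) {T : Mat m} (hT : tangentProj (P q) T = T)
    (X : Mat m) : metric (tangentProj (P q) X) T = metric X T := by
  rw [metric_tangentProj (h.quadric q hq), hT]

theorem tangentProj_reeb (hq : q ∈ O) :
    tangentProj (P q) (reebVec (P q) (N q)) = reebVec (P q) (N q) :=
  tangentProj_reebVec (h.quadric q hq) (h.tangent q hq)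

/-- In a Hopf hypersurface, the shape operator preserves the complement of the Reeb vector. -/
theorem metric_fderiv_normal_reeb (hH : IsHopfPatch O P N) (hq : q ∈ O) {v : E}
    (hv : metric (fderiv ℝ P q v) (reebVec (P q) (N q)) = 0) :
    metric (fderiv ℝ N q v) (reebVec (P q) (N q)) = 0 := by
  obtain ⟨u, α, hu, hα⟩ := hH q hq
  rw [← hu, h.metric_fderiv_normal_comm hq, ← h.metric_tangentProj_fderiv hq
    (h.tangentProj_fderiv hq v), ← neg_neg (tangentProj _ _), hα, metric_neg_left,
    metric_smul_left, metric_comm, hv, mul_zero, neg_zero]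

/-- The derivative of the curvature along a hypersurface. -/
theorem exists_curvForm_eq (hC : IsCParallelPatch O P N) (hq : q ∈ O) {v : E}
    (hv : metric (fderiv ℝ P q v) (reebVec (P q) (N q)) = 0) {Y₀ : Mat m}
    (hY : tangentProj (P q) Y₀ = Y₀) (hYN : metric Y₀ (N q) = 0) :
    ∃ r : ℝ, curvForm Y₀ (tangentProj (P q) (fderiv ℝ N q v)) (N q) +
      curvForm Y₀ (N q) (tangentProj (P q) (fderiv ℝ N q v)) = r • N q := by
  -- Extends `Y₀` to a tangent field of the hypersurface: project to the quadric, then remove the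
  -- normal component.
  obtain ⟨Y, hYdef⟩ : ∃ Y : E → Mat m, Y = fun q' => tangentProj (P q') Y₀ -
    metric (tangentProj (P q') Y₀) (N q') • N q' := ⟨_, rfl⟩
  have hYc : ∀ q ∈ O, ContDiffAt ℝ ∞ Y q := fun q hq => by
    rw [hYdef]
    exact ((h.contDiffAt hq).mat_tangentProj contDiffAt_const).sub
      ((((h.contDiffAt hq).mat_tangentProj contDiffAt_const).metric (h.contDiffAt_normal hq)).smul
        (h.contDiffAt_normal hq))
  have hYt : ∀ q ∈ O, tangentProj (P q) (Y q) = Y q := fun q hq => by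
    rw [hYdef, tangentProj_sub, tangentProj_smul, (h.quadric q hq).tangentProj_tangentProj,
      h.tangent q hq]
  have hYn : ∀ q ∈ O, metric (Y q) (N q) = 0 := fun q hq => by
    rw [hYdef, metric_sub_left, metric_smul_left, h.unit q hq, mul_one, sub_self]
  have hYq : Y q = Y₀ := by
    rw [hYdef]
    simp only [hY, hYN, zero_smul, sub_zero]
  have hP := h.quadric q hq
  have hYd := (hYc q hq).differentiableAt (n := ∞) (by simp)
  have hNd := h.differentiableAt_normal hq
  have key := hC Y (fun q hq => (hYc q hq).contDiffWithinAt) hYt hYn q hq v hv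
  have eY := h.fderiv_field hq hYd hYt v
  have eN := h.fderiv_field hq hNd h.tangent v
  have tP := h.tangentProj_fderiv hq v
  have evY := isEven_tangentProjDeriv hP tP (hYt q hq)
  have evN := isEven_tangentProjDeriv hP tP (h.tangent q hq)
  have tY := hP.tangentProj_tangentProj (fderiv ℝ Y q v)
  have tN := hP.tangentProj_tangentProj (fderiv ℝ N q v)
  set Y' := tangentProj (P q) (fderiv ℝ Y q v)
  set N' := tangentProj (P q) (fderiv ℝ N q v)
  have oY := isOdd_of_tangent hP (hYt q hq)
  have oN := isOdd_of_tangent hP (h.tangent q hq)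
  -- The normal parts of dY and dN are even. A curvature term with one even and two odd arguments is
  -- even, so the projection kills it.
  have e : tangentProj (P q) (fderiv ℝ (fun q' => curvForm (Y q') (N q') (N q')) q v) =
      curvForm Y' (N q) (N q) + curvForm (Y q) N' (N q) + curvForm (Y q) (N q) N' := by
    rw [fderiv_curvForm hYd hNd hNd, eY, eN, curvForm_add₁, curvForm_add₂, curvForm_add₃]
    simp only [tangentProj_add]
    rw [(isEven_curvForm_of_even_left evY oN oN).tangentProj_eq_zero hP,
      (isEven_curvForm_of_even_middle oY evN oN).tangentProj_eq_zero hP,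
      (isEven_curvForm_of_even_right oY oN evN).tangentProj_eq_zero hP,
      tangentProj_curvForm hP tY (h.tangent q hq) (h.tangent q hq),
      tangentProj_curvForm hP (hYt q hq) tN (h.tangent q hq),
      tangentProj_curvForm hP (hYt q hq) (h.tangent q hq) tN]
    simp only [zero_add]
  -- The two terms R(Y', N)N cancel; the multiple of N is the normal component subtracted by the
  -- connection.
  rw [e, curvForm_sub_smul, hYq] at key
  rw [sub_sub, sub_eq_zero, add_assoc, add_comm (curvForm Y' _ _)] at key
  exact ⟨_, add_right_cancel key⟩

/-- The shape operator vanishes on the complement of the Reeb vector. -/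
theorem tangentProj_fderiv_normal (hm : 3 ≤ m) (hH : IsHopfPatch O P N)
    (hC : IsCParallelPatch O P N) (hq : q ∈ O) {v : E}
    (hv : metric (fderiv ℝ P q v) (reebVec (P q) (N q)) = 0) :
    tangentProj (P q) (fderiv ℝ N q v) = 0 := by
  have h1 := h.metric_fderiv_normal_reeb hH hq hv
  have h2 := h.metric_fderiv_normal_self hq v
  rw [← h.metric_tangentProj_fderiv hq (h.tangentProj_reeb hq)] at h1
  rw [← h.metric_tangentProj_fderiv hq (h.tangent q hq)] at h2
  exact eq_zero_of_curvForm hm (h.quadric q hq) (h.tangent q hq)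
    ((h.quadric q hq).tangentProj_tangentProj _) (h.unit q hq) h2 h1
    fun Y hY hYN => h.exists_curvForm_eq hC hq hv hY hYN

/-- A Hopf hypersurface of the quadric has no `𝒞`-parallel normal Jacobi operator. -/
theorem not_isHopf_and_isCParallel (hm : 3 ≤ m) (hH : IsHopfPatch O P N)
    (hC : IsCParallelPatch O P N) : q ∉ O := by
  intro hq
  -- Here η = g(·, ξ), and `β` below is -g(S·, ξ), both pulled back to the parameter space.
  set η : E → E → ℝ := fun v q => metric (fderiv ℝ P q v) (reebVec (P q) (N q)) with hη
  set β : E → E → ℝ := fun v q => metric (fderiv ℝ N q v) (reebVec (P q) (N q)) with hβ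
  have hβ0 : ∀ q ∈ O, ∀ v, η v q = 0 → β v q = 0 := fun q hq v hv => by
    simp only [hβ]
    rw [← h.metric_tangentProj_fderiv hq (h.tangentProj_reeb hq),
      h.tangentProj_fderiv_normal hm hH hC hq hv, metric_zero_left]
  have hunit : ∀ q ∈ O, metric (reebVec (P q) (N q)) (reebVec (P q) (N q)) = 1 := fun q hq => by
    rw [(metric_reebVec (h.quadric q hq) (h.tangent q hq)).2, h.unit q hq]
  -- The kernel of η lies in that of β, so the forms are proportional. The cross-multiplied form can
  -- be differentiated without knowing that the principal curvature is smooth.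
  have hprop : ∀ q ∈ O, ∀ v w, β v q * η w q = β w q * η v q := by
    intro q hq
    obtain ⟨u, -, hu, -⟩ := hH q hq
    have h1 : η u q = 1 := by simp only [hη]; rw [hu, hunit q hq]
    have h2 : ∀ v, β v q = η v q * β u q := by
      intro v
      have h3 : η (v - η v q • u) q = 0 := by
        simp only [hη] at h1 ⊢
        rw [map_sub, map_smul, metric_sub_left, metric_smul_left, h1, mul_one, sub_self]
      have h4 := hβ0 q hq _ h3
      simp only [hβ] at h4 ⊢
      rw [map_sub, map_smul, metric_sub_left, metric_smul_left] at h4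
      linarith
    intro v w
    rw [h2 v, h2 w]; ring
  have hPd := h.contDiffAt hq
  have hNd := h.contDiffAt_normal hq
  have hξd : DifferentiableAt ℝ (fun q => reebVec (P q) (N q)) q :=
    (hPd.reebVec hNd).differentiableAt (by simp)
  have hP2 : ∀ v, DifferentiableAt ℝ (fun q => fderiv ℝ P q v) q := fun v =>
    (contDiffAt_fderiv_apply hPd v).differentiableAt (by simp)
  have hN2 : ∀ v, DifferentiableAt ℝ (fun q => fderiv ℝ N q v) q := fun v =>
    (contDiffAt_fderiv_apply hNd v).differentiableAt (by simp)
  have hηd : ∀ v, DifferentiableAt ℝ (η v) q := fun v =>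
    ((contDiffAt_fderiv_apply hPd v).metric (hPd.reebVec hNd)).differentiableAt (by simp)
  have hβd : ∀ v, DifferentiableAt ℝ (β v) q := fun v =>
    ((contDiffAt_fderiv_apply hNd v).metric (hPd.reebVec hNd)).differentiableAt (by simp)
  obtain ⟨u, -, hu, -⟩ := hH q hq
  have hηu : η u q = 1 := by simp only [hη]; rw [hu, hunit q hq]
  -- At `q` the factors `η w` and `β w` vanish and `η u` is 1, so only these two terms survive.
  have hder : ∀ v w, η w q = 0 → fderiv ℝ (β w) q v = β u q * fderiv ℝ (η w) q v := by
    intro v w hw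
    have e : (fun q => β w q * η u q) =ᶠ[nhds q] fun q => β u q * η w q :=
      Filter.eventually_of_mem (h.isOpen.mem_nhds hq) fun q hq => hprop q hq w u
    have h1 := congrArg (fun L : E →L[ℝ] ℝ => L v) e.fderiv_eq
    simp only [fderiv_fun_mul (hβd _) (hηd _)] at h1
    simp only [add_apply, smul_apply, smul_eq_mul, hηu, hw, hβ0 q hq w hw] at h1
    linarith
  have htT := h.tangentProj_fderiv hq
  have hII : ∀ v, η v q = 0 →
      fderiv ℝ N q v = tangentProjDeriv (P q) (fderiv ℝ P q v) (N q) := fun v hv => by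
    have := h.fderiv_field hq (h.differentiableAt_normal hq) h.tangent v
    rwa [h.tangentProj_fderiv_normal hm hH hC hq hv, add_zero] at this
  have hdξ := fderiv_reebVec (h.differentiableAt hq) (h.differentiableAt_normal hq)
  -- The parameters `v₁`, `v₂` lift the tangent vectors of x and ix, with x orthogonal to n and n̄.
  -- Since S vanishes on them, dN is purely the second fundamental form, c x n* + c̄ n x* for c = 1
  -- and c = i.
  obtain ⟨v₁, v₂, A, hη₁, hη₂, hA₁, hA₂, hd₁, hd₂, hA⟩ : ∃ v₁ v₂ : E, ∃ A : Mat m,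
      η v₁ q = 0 ∧ η v₂ q = 0 ∧
      fderiv ℝ N q v₁ = A ∧ fderiv ℝ (fun q => reebVec (P q) (N q)) q v₂ = -A ∧
      fderiv ℝ (fun q => reebVec (P q) (N q)) q v₁ = fderiv ℝ N q v₂ ∧
      IsEven (P q) (fderiv ℝ N q v₂) ∧ A ≠ 0 := by
    have hN := h.tangent q hq
    have hu1 := h.unit q hq
    have hr := h.range q hq
    have hev := fun v => isEven_tangentProjDeriv (h.quadric q hq) (htT v) hN
    obtain ⟨z, hz, hPz⟩ := h.quadric q hq
    rw [hPz] at hN hr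
    obtain ⟨n, hn, hNn⟩ := (tangentProj_eq_self_iff hz).1 hN
    rw [hNn] at hr
    have hn1 : star n ⬝ᵥ n = 1 := by
      rw [hNn, metric_tan hz hn hn, star_dot_self, Complex.ofReal_re] at hu1
      rw [star_dot_self, hu1, Complex.ofReal_one]
    obtain ⟨x, hx0, hx, hnx, hnx'⟩ := exists_horiz_orthogonal hm z n
    have hxn : star x ⬝ᵥ n = 0 := by rw [star_dot_comm, hnx, star_zero]
    have hxn' : x ⬝ᵥ n = 0 := by rw [dotProduct_comm, hnx']
    have hc : ∀ c : ℂ, ∃ v, fderiv ℝ P q v = tan z (c • x) ∧ η v q = 0 ∧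
        fderiv ℝ N q v = c • outer x n + star c • outer n x ∧
        fderiv ℝ (fun q => reebVec (P q) (N q)) q v =
          -(Complex.I • (star c • outer n x - c • outer x n)) := by
      intro c
      obtain ⟨v, hv⟩ := hr (tan z (c • x)) (tangentProj_tan hz (hx.smul c))
        (by rw [metric_tan hz (hx.smul c) hn]; simp [smul_dotProduct, hxn])
      have hηv : η v q = 0 := by
        simp only [hη]
        rw [hv, hPz, hNn, reebVec_tan hz hn, metric_tan hz (hx.smul c) (hn.smul _)]
        simp [smul_dotProduct, hxn]
      have hNv : fderiv ℝ N q v = c • outer x n + star c • outer n x := by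
        rw [hII v hηv, hv, hPz, hNn, tangentProjDeriv_tan hz (hx.smul c) hn]
        simp only [star_smul, smul_dotProduct, dotProduct_smul, hxn, hnx, hxn', ← star_dot,
          star_zero, smul_zero, zero_smul, add_zero, sub_zero, outer_smul_left, outer_smul_right]
        rw [add_comm]
      refine ⟨v, hv, hηv, hNv, ?_⟩
      rw [hdξ, hNv, hv, hPz, hNn]
      simp only [tan, add_mul, mul_add, outer_mul_outer, smul_mul_assoc, mul_smul_comm,
        outer_smul_left, outer_smul_right, hz.unit, hn.orth, hn.orth', hx.orth, hx.orth', hnx, hxn,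
        zero_smul, smul_zero, one_smul, add_zero, zero_add]
    obtain ⟨v₁, hv₁, hη₁, hN₁, hR₁⟩ := hc 1
    obtain ⟨v₂, hv₂, hη₂, hN₂, hR₂⟩ := hc Complex.I
    refine ⟨v₁, v₂, fderiv ℝ N q v₁, hη₁, hη₂, rfl, ?_, ?_, ?_, ?_⟩
    · rw [hR₂, hN₁, Complex.star_def, Complex.conj_I, map_one, smul_sub, smul_smul, smul_smul,
        mul_neg, Complex.I_mul_I]
      module
    · rw [hR₁, hN₂, Complex.star_def, Complex.conj_I, map_one]
      module
    · rw [hII v₂ hη₂]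
      exact hev v₂
    -- Applied to n, the matrix x n* + n x* gives x, which is nonzero.
    · intro h0
      rw [hN₁, star_one, one_smul, one_smul] at h0
      have h1 := congrArg (fun X => act X n) h0
      simp only [act_add, act_outer, hn1, hxn, one_smul, zero_smul, add_zero] at h1
      exact hx0 (h1.trans (Matrix.zero_mulVec n))
  have hAe : IsEven (P q) A := by
    rw [← hA₁, hII v₁ hη₁]
    exact isEven_tangentProjDeriv (h.quadric q hq) (htT v₁) (h.tangent q hq)
  have hzero : ∀ v B, IsEven (P q) B → metric (fderiv ℝ P q v) B = 0 := fun v B hB => by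
    rw [← htT v, metric_tangentProj (h.quadric q hq), hB.tangentProj_eq_zero (h.quadric q hq),
      metric_zero_right]
  -- Subtracting the two identities cancels the symmetric second derivatives of P and N. The values
  -- of dξ are even, hence orthogonal to the tangent values of dP. What remains is |dN(v₂)|² + |A|²
  -- = 0.
  have e1 := hder v₁ v₂ hη₂
  have e2 := hder v₂ v₁ hη₁
  simp only [hβ, hη] at e1 e2
  rw [fderiv_metric (hN2 _) hξd, fderiv_metric (hP2 _) hξd] at e1 e2
  rw [fderiv_fderiv_comm hPd v₂ v₁, fderiv_fderiv_comm hNd v₂ v₁, hA₂, hA₁,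
    hzero v₁ _ hAe.neg, metric_neg_right] at e2
  rw [hd₁, hzero v₂ _ hd₂] at e1
  have h1 := metric_self_nonneg (fderiv ℝ N q v₂)
  have h2 := metric_self_nonneg A
  exact hA (eq_zero_of_metric_self (by linarith))

end IsHypersurfacePatch

end

section

/-! ### Dimension of the tangent space and local unit normals -/

/-- The tangent space of the quadric at the point `P`, as a real vector space. -/
def tangentSubmodule (P : Mat m) : Submodule ℝ (Mat m) :=
  LinearMap.eqLocus (tangentProjLin P) LinearMap.id

theorem mem_tangentSubmodule {P X : Mat m} : X ∈ tangentSubmodule P ↔ tangentProj P X = X :=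
  Iff.rfl

/-- The linear map whose kernel consists of the vectors orthogonal to `z` and its conjugate. -/
def horizMap (z : Fin (m + 2) → ℂ) : (Fin (m + 2) → ℂ) →ₗ[ℂ] (Fin 2 → ℂ) :=
  (Matrix.of ![star z, z]).mulVecLin

theorem mem_ker_horizMap {z v : Fin (m + 2) → ℂ} :
    v ∈ LinearMap.ker (horizMap z) ↔ IsHoriz z v := by
  constructor
  · intro h
    exact ⟨congrFun h 0, congrFun h 1⟩
  · intro h
    refine funext fun i => ?_
    fin_cases i
    · exact h.orth
    · exact h.dot

theorem finrank_ker_horizMap {z : Fin (m + 2) → ℂ} (hz : IsUnitIsotropic z) :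
    Module.finrank ℂ (LinearMap.ker (horizMap z)) = m := by
  have hs : Function.Surjective (horizMap z) := by
    intro c
    refine ⟨c 0 • z + c 1 • star z, funext fun i => ?_⟩
    fin_cases i
    · change star z ⬝ᵥ (c 0 • z + c 1 • star z) = c 0
      simp [dotProduct_add, hz.unit, hz.isotropic']
    · change z ⬝ᵥ (c 0 • z + c 1 • star z) = c 1
      simp [dotProduct_add, hz.isotropic, hz.unit']
  have h := LinearMap.finrank_range_add_finrank_ker (horizMap z)
  rw [LinearMap.range_eq_top.2 hs, finrank_top] at h
  simp at h
  omega

theorem IsQuadricPoint.finrank_tangentSubmodule {P : Mat m} (hP : IsQuadricPoint P) :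
    Module.finrank ℝ (tangentSubmodule P) = 2 * m := by
  obtain ⟨z, hz, rfl⟩ := hP
  refine Eq.trans ?_ ((finrank_real_of_complex (LinearMap.ker (horizMap z))).trans
    (congrArg (2 * ·) (finrank_ker_horizMap hz)))
  let L : LinearMap.ker (horizMap z) →ₗ[ℝ] tangentSubmodule (outer z z) :=
    { toFun := fun v => ⟨tan z v, tangentProj_tan hz (mem_ker_horizMap.1 v.2)⟩
      map_add' := fun v w => Subtype.ext tan_add
      map_smul' := fun c v => Subtype.ext (tan_smul c) }
  refine (LinearEquiv.finrank_eq (LinearEquiv.ofBijective L ⟨fun v w h => ?_, fun X => ?_⟩)).symm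
  · exact Subtype.ext (tan_injective hz (mem_ker_horizMap.1 v.2) (mem_ker_horizMap.1 w.2)
      (congrArg Subtype.val h))
  · obtain ⟨v, hv, h⟩ := (tangentProj_eq_self_iff hz).1 X.2
    exact ⟨⟨v, mem_ker_horizMap.2 hv⟩, Subtype.ext h.symm⟩

variable {E : Type*} [NormedAddCommGroup E] [NormedSpace ℝ E] [FiniteDimensional ℝ E]

/-- A tangent vector of the quadric is a sum of a tangent vector and a normal vector of a
hypersurface. -/
theorem exists_tangent_add_normal (hm : 1 ≤ m) (hE : Module.finrank ℝ E = 2 * m - 1) {P N : Mat m}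
    (hP : IsQuadricPoint P) {D : E →ₗ[ℝ] Mat m} (hD : Function.Injective D)
    (hDt : ∀ v, tangentProj P (D v) = D v) (hN : tangentProj P N = N) (hu : metric N N = 1)
    (hn : ∀ v, metric N (D v) = 0) {T : Mat m} (hT : tangentProj P T = T) :
    ∃ v, ∃ c : ℝ, T = D v + c • N := by
  let L : E × ℝ →ₗ[ℝ] tangentSubmodule P :=
    LinearMap.codRestrict (tangentSubmodule P)
      (D.comp (LinearMap.fst ℝ E ℝ) + (LinearMap.snd ℝ E ℝ).smulRight N) (fun p => by
        rw [mem_tangentSubmodule]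
        simp only [LinearMap.add_apply, LinearMap.comp_apply, LinearMap.fst_apply,
          LinearMap.smulRight_apply, LinearMap.snd_apply]
        rw [tangentProj_add, tangentProj_smul, hDt, hN])
  have hL : ∀ p, (L p : Mat m) = D p.1 + p.2 • N := fun p => rfl
  have hinj : Function.Injective L := by
    rw [← LinearMap.ker_eq_bot, LinearMap.ker_eq_bot']
    rintro ⟨v, c⟩ h
    have h1 : D v + c • N = 0 := congrArg Subtype.val h
    have h2 : c = 0 := by
      have := congrArg (metric N) h1
      rwa [metric_add_right, metric_smul_right, hn, hu, metric_zero_right, mul_one,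
        zero_add] at this
    rw [h2, zero_smul, add_zero] at h1
    rw [h2, (map_eq_zero_iff D hD).1 h1]
    rfl
  have hsurj : Function.Surjective L := by
    refine (LinearMap.injective_iff_surjective_of_finrank_eq_finrank ?_).1 hinj
    rw [Module.finrank_prod, hP.finrank_tangentSubmodule, hE, Module.finrank_self]
    -- The subtraction in 2m - 1 is truncated; 1 ≤ m gives (2m - 1) + 1 = 2m.
    omega
  obtain ⟨p, hp⟩ := hsurj ⟨T, hT⟩
  exact ⟨p.1, p.2, (congrArg Subtype.val hp).symm⟩

theorem metric_self_pos {X : Mat m} (hX : X ≠ 0) : 0 < metric X X :=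
  lt_of_le_of_ne (metric_self_nonneg X) fun h => hX (eq_zero_of_metric_self h.symm)

theorem metric_normalize {X : Mat m} (hX : X ≠ 0) :
    metric ((√(metric X X))⁻¹ • X) ((√(metric X X))⁻¹ • X) = 1 := by
  have h := metric_self_pos hX
  have h2 := Real.mul_self_sqrt h.le
  have h3 : √(metric X X) ≠ 0 := (Real.sqrt_pos.2 h).ne'
  rw [metric_smul_left, metric_smul_right]
  field_simp
  linarith

/-- Orthogonality to the image of `D` imposes at most 2m - 1 real conditions on a tangent space of
dimension 2m. -/
theorem exists_unit_normal (hm : 1 ≤ m) (hE : Module.finrank ℝ E = 2 * m - 1) {P : Mat m}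
    (hP : IsQuadricPoint P) (D : E →ₗ[ℝ] Mat m) :
    ∃ N, tangentProj P N = N ∧ metric N N = 1 ∧ ∀ v, metric N (D v) = 0 := by
  let L : tangentSubmodule P →ₗ[ℝ] (E →ₗ[ℝ] ℝ) :=
    ((metricForm m).compl₂ D).comp (tangentSubmodule P).subtype
  have h := LinearMap.ker_ne_bot_of_finrank_lt (f := L) (by
    rw [hP.finrank_tangentSubmodule, Module.finrank_linearMap, Module.finrank_self, hE]; omega)
  obtain ⟨X, hX, hX0⟩ := (Submodule.ne_bot_iff _).1 h
  have hX1 : (X : Mat m) ≠ 0 := fun h => hX0 (Subtype.ext h)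
  refine ⟨(√(metric (X : Mat m) X))⁻¹ • (X : Mat m), ?_, metric_normalize hX1, fun v => ?_⟩
  · rw [tangentProj_smul, mem_tangentSubmodule.1 X.2]
  · rw [metric_smul_left, show metric (X : Mat m) (D v) = 0 from LinearMap.congr_fun hX v,
      mul_zero]

/-- An immersed hypersurface of the quadric has a unit normal field near every point. -/
theorem exists_isHypersurfacePatch (hm : 1 ≤ m) (hE : Module.finrank ℝ E = 2 * m - 1) {O : Set E}
    {P : E → Mat m} (hO : IsOpen O) (hQ : ∀ q ∈ O, IsQuadricPoint (P q))
    (hP : ContDiffOn ℝ ∞ P O) (hinj : ∀ q ∈ O, Function.Injective (fderiv ℝ P q)) {q₀ : E}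
    (hq₀ : q₀ ∈ O) :
    ∃ O' ⊆ O, q₀ ∈ O' ∧ ∃ N, IsHypersurfacePatch O' P N := by
  have hPd : ∀ q ∈ O, ContDiffAt ℝ ∞ P q := fun q hq => hP.contDiffAt (hO.mem_nhds hq)
  have htan : ∀ q ∈ O, ∀ v, tangentProj (P q) (fderiv ℝ P q v) = fderiv ℝ P q v := fun q hq v =>
    tangentProj_fderiv_base ((hPd q hq).differentiableAt (by simp))
      (Filter.eventually_of_mem (hO.mem_nhds hq) hQ) v
  obtain ⟨N₀, hN₀, hu₀, hn₀⟩ := exists_unit_normal hm hE (hQ q₀ hq₀) (fderiv ℝ P q₀).toLinearMap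
  let b := Module.finBasisOfFinrankEq ℝ E hE
  let T := tangentSubmodule (P q₀)
  -- Records the products of the projected vector with the coordinate tangent vectors at `q` and
  -- with the fixed `N₀`. It is invertible at `q₀`, hence nearby, and the preimage of (0, 1) gives a
  -- smooth nonvanishing normal field.
  let Φ : E → T →L[ℝ] ((Fin (2 * m - 1) → ℝ) × ℝ) := fun q => LinearMap.toContinuousLinearMap
    (LinearMap.prod
      (LinearMap.pi fun i => ((metricForm m).flip (fderiv ℝ P q (b i))).comp
        ((tangentProjLin (P q)).comp T.subtype))
      (((metricForm m).flip N₀).comp ((tangentProjLin (P q)).comp T.subtype)))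
  have hΦ : ∀ q (X : T), Φ q X = (fun i => metric (tangentProj (P q) X) (fderiv ℝ P q (b i)),
    metric (tangentProj (P q) X) N₀) := fun q X => rfl
  have hΦc : ContDiffOn ℝ ∞ Φ O := by
    rw [contDiffOn_clm_apply]
    intro X q hq
    refine ContDiffAt.contDiffWithinAt ?_
    simp only [hΦ]
    have h1 := (hPd q hq).mat_tangentProj (contDiffAt_const (c := (X : Mat m)))
    refine ContDiffAt.prodMk (contDiffAt_pi.2 fun i => ?_) (h1.metric contDiffAt_const)
    exact h1.metric (contDiffAt_fderiv_apply (hPd q hq) (b i))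
  have hΦ₀ : Function.Injective (Φ q₀) := by
    rw [injective_iff_map_eq_zero]
    intro X hX
    rw [hΦ, mem_tangentSubmodule.1 X.2] at hX
    have h1 : ∀ v, metric (X : Mat m) (fderiv ℝ P q₀ v) = 0 := by
      have : (metricForm m X).comp (fderiv ℝ P q₀).toLinearMap = 0 :=
        b.ext fun i => congrFun (congrArg Prod.fst hX) i
      exact fun v => LinearMap.congr_fun this v
    have h2 : metric (X : Mat m) N₀ = 0 := congrArg Prod.snd hX
    obtain ⟨v, c, hc⟩ := exists_tangent_add_normal hm hE (hQ q₀ hq₀)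
      (D := (fderiv ℝ P q₀).toLinearMap) (hinj q₀ hq₀) (htan q₀ hq₀) hN₀ hu₀ hn₀ X.2
    refine Subtype.ext (eq_zero_of_metric_self ?_)
    conv_lhs => arg 2; rw [hc]
    rw [metric_add_right, metric_smul_right, h2, mul_zero, add_zero]
    exact h1 v
  let e : T ≃L[ℝ] ((Fin (2 * m - 1) → ℝ) × ℝ) :=
    (LinearEquiv.ofInjectiveOfFinrankEq (Φ q₀).toLinearMap hΦ₀ (by
      rw [(hQ q₀ hq₀).finrank_tangentSubmodule, Module.finrank_prod, Module.finrank_fin_fun,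
        Module.finrank_self]; omega)).toContinuousLinearEquiv
  have he : (e : T →L[ℝ] ((Fin (2 * m - 1) → ℝ) × ℝ)) = Φ q₀ := ContinuousLinearMap.ext fun X => rfl
  let R : Set (T →L[ℝ] ((Fin (2 * m - 1) → ℝ) × ℝ)) :=
    Set.range ((↑) : (T ≃L[ℝ] ((Fin (2 * m - 1) → ℝ) × ℝ)) → _)
  have hR : IsOpen R := ContinuousLinearEquiv.isOpen
  have hO' : IsOpen (O ∩ Φ ⁻¹' R) := hΦc.continuousOn.isOpen_inter_preimage hO hR
  let N₁ : E → Mat m := fun q => tangentProj (P q) ((ContinuousLinearMap.inverse (Φ q) (0, 1) : T))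
  have hN₁ : ∀ q ∈ O ∩ Φ ⁻¹' R, (∀ v, metric (N₁ q) (fderiv ℝ P q v) = 0) ∧
      metric (N₁ q) N₀ = 1 := by
    rintro q ⟨hq, e', he'⟩
    have h1 : Φ q (ContinuousLinearMap.inverse (Φ q) (0, 1)) = (0, 1) := by
      rw [← he', ContinuousLinearMap.inverse_equiv]
      exact e'.apply_symm_apply _
    rw [hΦ] at h1
    refine ⟨?_, congrArg Prod.snd h1⟩
    have : (metricForm m (N₁ q)).comp (fderiv ℝ P q).toLinearMap = 0 :=
      b.ext fun i => congrFun (congrArg Prod.fst h1) i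
    exact fun v => LinearMap.congr_fun this v
  have hN₁0 : ∀ q ∈ O ∩ Φ ⁻¹' R, N₁ q ≠ 0 := fun q hq h => by
    have := (hN₁ q hq).2
    rw [h, metric_zero_left] at this
    exact zero_ne_one this
  have hN₁c : ∀ q ∈ O ∩ Φ ⁻¹' R, ContDiffAt ℝ ∞ N₁ q := by
    rintro q ⟨hq, e', he'⟩
    have h2 : ContDiffAt ℝ ∞ ContinuousLinearMap.inverse (Φ q) := by
      rw [← he']
      exact contDiffAt_map_inverse e'
    have h1 : ContDiffAt ℝ ∞ (fun q => ContinuousLinearMap.inverse (Φ q)) q :=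
      h2.comp q (hΦc.contDiffAt (hO.mem_nhds hq))
    exact (hPd q hq).mat_tangentProj
      (T.subtypeL.contDiff.contDiffAt.comp q (h1.clm_apply contDiffAt_const))
  have hN₁t : ∀ q ∈ O ∩ Φ ⁻¹' R, tangentProj (P q) (N₁ q) = N₁ q := fun q hq =>
    (hQ q hq.1).tangentProj_tangentProj _
  let N : E → Mat m := fun q => (√(metric (N₁ q) (N₁ q)))⁻¹ • N₁ q
  have hNt : ∀ q ∈ O ∩ Φ ⁻¹' R, tangentProj (P q) (N q) = N q := fun q hq => by
    rw [tangentProj_smul, hN₁t q hq]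
  have hNu : ∀ q ∈ O ∩ Φ ⁻¹' R, metric (N q) (N q) = 1 := fun q hq => metric_normalize (hN₁0 q hq)
  have hNn : ∀ q ∈ O ∩ Φ ⁻¹' R, ∀ v, metric (N q) (fderiv ℝ P q v) = 0 := fun q hq v => by
    rw [metric_smul_left, (hN₁ q hq).1, mul_zero]
  refine ⟨O ∩ Φ ⁻¹' R, Set.inter_subset_left, ⟨hq₀, e, he⟩, N, hO', fun q hq => hQ q hq.1,
    hP.mono Set.inter_subset_left, fun q hq => ContDiffAt.contDiffWithinAt ?_, hNt, hNu, hNn, ?_⟩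
  · have h1 := metric_self_pos (hN₁0 q hq)
    exact ((((hN₁c q hq).metric (hN₁c q hq)).sqrt h1.ne').inv (Real.sqrt_pos.2 h1).ne').smul
      (hN₁c q hq)
  · intro q hq X hX hXN
    obtain ⟨v, c, hc⟩ := exists_tangent_add_normal hm hE (hQ q hq.1)
      (D := (fderiv ℝ P q).toLinearMap) (hinj q hq.1) (htan q hq.1) (hNt q hq) (hNu q hq)
      (hNn q hq) hX
    refine ⟨v, ?_⟩
    rw [hc, metric_add_left, metric_smul_left, hNu q hq, metric_comm] at hXN
    have h0 : c = 0 := by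
      have := hNn q hq v
      simp only [ContinuousLinearMap.coe_coe] at hXN
      rw [this] at hXN
      linarith
    rw [hc, h0, zero_smul, add_zero]
    rfl

end

/-! ### Hypersurfaces in charts -/

theorem exists_lineMatrix_eq {p : CP m} (hp : p ∈ quadric m) :
    ∃ (z : Fin (m + 2) → ℂ) (s : ℝ), s ≠ 0 ∧ IsUnitIsotropic z ∧ lineMatrix p = outer z z ∧
      p.rep = (s : ℂ) • z := by
  have h0 := p.rep_nonzero
  have hr : p.rep ⬝ᵥ p.rep = 0 := hp _ (by
    rw [Projectivization.submodule_eq]; exact Submodule.mem_span_singleton_self _)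
  generalize hrep : p.rep = r at *
  obtain ⟨t, ht⟩ : ∃ t : ℝ, star r ⬝ᵥ r = t := ⟨_, star_dot_self r⟩
  have ht0 : 0 < t := by
    have h1 := (norm_nonneg _).trans (norm_dot_self_le r)
    rw [ht, Complex.ofReal_re] at h1
    refine lt_of_le_of_ne h1 fun h => h0 (eq_zero_of_star_dot_self ?_)
    rw [ht, ← h]; simp
  have hs := Real.sqrt_pos.2 ht0
  have hsc : ((√t : ℝ) : ℂ) ≠ 0 := by exact_mod_cast hs.ne'
  have hst : ((√t : ℝ) : ℂ) * (√t : ℝ) = t := by exact_mod_cast Real.mul_self_sqrt ht0.le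
  have htc : (t : ℂ) ≠ 0 := by exact_mod_cast ht0.ne'
  refine ⟨((√t : ℝ) : ℂ)⁻¹ • r, √t, hs.ne', ⟨?_, ?_⟩, ?_, ?_⟩
  · rw [star_smul, smul_dotProduct, dotProduct_smul, ht, star_inv₀, Complex.star_def,
      Complex.conj_ofReal, smul_eq_mul, smul_eq_mul, ← mul_assoc, ← mul_inv, hst,
      inv_mul_cancel₀ htc]
  · rw [smul_dotProduct, dotProduct_smul, hr, smul_zero, smul_zero]
  · rw [lineMatrix, hrep, ht, outer_smul_left, outer_smul_right, star_inv₀, Complex.star_def,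
      Complex.conj_ofReal, smul_smul, ← mul_inv, hst]
  · rw [smul_smul, mul_inv_cancel₀ hsc, one_smul]

theorem isQuadricPoint_lineMatrix {p : CP m} (hp : p ∈ quadric m) :
    IsQuadricPoint (lineMatrix p) := by
  obtain ⟨z, s, -, hz, h, -⟩ := exists_lineMatrix_eq hp
  exact ⟨z, hz, h⟩

theorem mem_tangentSpace_iff {p : CP m} (hp : p ∈ quadric m) {X : Mat m} :
    X ∈ tangentSpace p ↔ tangentProj (lineMatrix p) X = X := by
  obtain ⟨z, s, hs, hz, h, hr⟩ := exists_lineMatrix_eq hp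
  have hsc : (s : ℂ) ≠ 0 := by exact_mod_cast hs
  rw [h, tangentProj_eq_self_iff hz]
  simp only [tangentSpace, Set.mem_ofPred_eq, hr]
  constructor
  · rintro ⟨v, h1, h2, rfl⟩
    -- The representative is s z with s real, so the factor moves from z to v in both rank one
    -- terms.
    refine ⟨(s : ℂ) • v, ⟨?_, ?_⟩, ?_⟩
    · simpa [smul_dotProduct, hs] using h1
    · simpa [smul_dotProduct, hs] using h2
    · simp only [tan, outer_smul_left, outer_smul_right, Complex.star_def, Complex.conj_ofReal]
  · rintro ⟨v, hv, rfl⟩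
    refine ⟨(s : ℂ)⁻¹ • v, ?_, ?_, ?_⟩
    · simp [smul_dotProduct, hv.orth]
    · simp [smul_dotProduct, hv.dot]
    · simp only [tan, outer_smul_left, outer_smul_right, Complex.star_def, Complex.conj_ofReal,
        smul_smul, map_inv₀, mul_inv_cancel₀ hsc, inv_mul_cancel₀ hsc, one_smul]

variable {M : Type*} [TopologicalSpace M] [ChartedSpace (Model m) M]

/-- The chain rule through one fixed chart, valid at every point of its domain. -/
theorem dir_eq_fderiv [IsManifold 𝓘(ℝ, Model m) ∞ M] {x₀ x : M}
    (hx : x ∈ (extChartAt 𝓘(ℝ, Model m) x₀).source) {Y : M → Mat m} {Z : Model m → Mat m}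
    (hY : ∀ᶠ x' in nhds x, Y x' = Z (extChartAt 𝓘(ℝ, Model m) x₀ x'))
    (hZ : DifferentiableAt ℝ Z (extChartAt 𝓘(ℝ, Model m) x₀ x))
    (v : TangentSpace 𝓘(ℝ, Model m) x) :
    dir Y x v = fderiv ℝ Z (extChartAt 𝓘(ℝ, Model m) x₀ x)
      (mfderiv 𝓘(ℝ, Model m) 𝓘(ℝ, Model m) (extChartAt 𝓘(ℝ, Model m) x₀) x v) := by
  have h1 : mfderiv 𝓘(ℝ, Model m) 𝓘(ℝ, Mat m) Y x =
      mfderiv 𝓘(ℝ, Model m) 𝓘(ℝ, Mat m) (Z ∘ extChartAt 𝓘(ℝ, Model m) x₀) x :=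
    Filter.EventuallyEq.mfderiv_eq hY
  have h2 : MDifferentiableAt 𝓘(ℝ, Model m) 𝓘(ℝ, Model m) (extChartAt 𝓘(ℝ, Model m) x₀) x :=
    ((contMDiffAt_extChartAt' (n := ∞) (by rwa [extChartAt_source] at hx))).mdifferentiableAt
      (by simp)
  have h3 := mfderiv_comp x hZ.mdifferentiableAt h2
  rw [mfderiv_eq_fderiv] at h3
  have h4 : dir Y x v = mfderiv 𝓘(ℝ, Model m) 𝓘(ℝ, Mat m) Y x v := rfl
  rw [h4, h1, h3]
  rfl

/-- No real hypersurface of the quadric is Hopf with `𝒞`-parallel normal Jacobi operator. -/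
theorem not_isHopf_and_hasCParallelNormalJacobi [Nonempty M] [IsManifold 𝓘(ℝ, Model m) ∞ M]
    (hm : 3 ≤ m) {f : M → CP m} (hf : IsRealHypersurface f) :
    ¬ (IsHopf f ∧ HasCParallelNormalJacobi f) := by
  rintro ⟨hH, hC⟩
  obtain ⟨x₀⟩ := ‹Nonempty M›
  have : IsManifold 𝓘(ℝ, Model m) 1 M := IsManifold.of_le (n := ∞) (by simp)
  set φ := extChartAt 𝓘(ℝ, Model m) x₀ with hφ
  set P : Model m → Mat m := fun q => emb f (φ.symm q) with hPdef
  have hPφ : ∀ x ∈ φ.source, P (φ x) = emb f x := fun x hx => by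
    simp only [hPdef, φ.left_inv hx]
  have hso : IsOpen φ.source := isOpen_extChartAt_source x₀
  have hto : IsOpen φ.target := isOpen_extChartAt_target x₀
  have hPc : ContDiffOn ℝ ∞ P φ.target := by
    rw [← contMDiffOn_iff_contDiffOn]
    exact hf.smooth.comp_contMDiffOn (contMDiffOn_extChartAt_symm x₀)
  have hPd : ∀ q ∈ φ.target, DifferentiableAt ℝ P q := fun q hq =>
    (hPc.contDiffAt (hto.mem_nhds hq)).differentiableAt (by simp)
  -- Bijectivity transfers tangent vectors both ways: the immersion property descends to the chart,
  -- and parameter vectors lift to M.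
  have hbij : ∀ x ∈ φ.source, Function.Bijective
      (mfderiv 𝓘(ℝ, Model m) 𝓘(ℝ, Model m) φ x) := fun x hx =>
    (isInvertible_mfderiv_extChartAt hx).bijective
  have hdP : ∀ x ∈ φ.source, ∀ v, dir (emb f) x v =
      fderiv ℝ P (φ x) (mfderiv 𝓘(ℝ, Model m) 𝓘(ℝ, Model m) φ x v) := fun x hx v =>
    dir_eq_fderiv hx (Filter.eventually_of_mem (hso.mem_nhds hx) fun x' hx' => (hPφ x' hx').symm)
      (hPd _ (φ.map_source hx)) v
  have hQ : ∀ q ∈ φ.target, IsQuadricPoint (P q) := fun q _ =>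
    isQuadricPoint_lineMatrix (hf.mem_quadric _)
  have hinj : ∀ q ∈ φ.target, Function.Injective (fderiv ℝ P q) := by
    intro q hq a b hab
    have hx := φ.map_target hq
    obtain ⟨a', ha'⟩ := (hbij _ hx).2 a
    obtain ⟨b', hb'⟩ := (hbij _ hx).2 b
    have : a' = b' := by
      apply hf.immersion (φ.symm q)
      rw [hdP _ hx, hdP _ hx, ha', hb', φ.right_inv hq, hab]
    rw [← ha', ← hb', this]
  obtain ⟨O, hO, hx₀, N, h⟩ := exists_isHypersurfacePatch (by omega : 1 ≤ m)
    (by simp : Module.finrank ℝ (Model m) = 2 * m - 1) hto hQ hPc hinj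
    (φ.map_source (mem_extChartAt_source x₀))
  set U := φ.source ∩ φ ⁻¹' O with hU
  have hφc : ContMDiffOn 𝓘(ℝ, Model m) 𝓘(ℝ, Model m) ∞ φ φ.source := by
    rw [hφ, extChartAt_source]; exact contMDiffOn_extChartAt
  have hUo : IsOpen U := hφc.continuousOn.isOpen_inter_preimage hso h.isOpen
  have hsm : ∀ {Z : Model m → Mat m}, ContDiffOn ℝ ∞ Z O →
      ContMDiffOn 𝓘(ℝ, Model m) 𝓘(ℝ, Mat m) ∞ (fun x => Z (φ x)) U := fun {Z} hZ =>
    (contMDiffOn_iff_contDiffOn.2 hZ).comp (hφc.mono Set.inter_subset_left) fun x hx => hx.2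
  have hdir : ∀ {Z : Model m → Mat m} {Y : M → Mat m}, (∀ x ∈ U, Y x = Z (φ x)) →
      ∀ x ∈ U, DifferentiableAt ℝ Z (φ x) → ∀ v, dir Y x v =
      fderiv ℝ Z (φ x) (mfderiv 𝓘(ℝ, Model m) 𝓘(ℝ, Model m) φ x v) := fun {Z Y} hY x hx hZ v =>
    dir_eq_fderiv hx.1 (Filter.eventually_of_mem (hUo.mem_nhds hx) hY) hZ v
  have hN : IsUnitNormalOn f U (fun x => N (φ x)) := by
    refine ⟨hsm h.contDiffOn_normal, fun x hx => ?_, fun x hx => h.unit _ hx.2, fun x hx v => ?_⟩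
    · rw [mem_tangentSpace_iff (hf.mem_quadric x)]
      have := h.tangent _ hx.2
      rwa [hPφ x hx.1] at this
    · rw [hdP x hx.1]
      exact h.normal _ hx.2 _
  have hpt : ∀ q ∈ O, φ.symm q ∈ U ∧ φ (φ.symm q) = q := fun q hq =>
    ⟨⟨φ.map_target (hO hq), by rw [Set.mem_preimage, φ.right_inv (hO hq)]; exact hq⟩,
      φ.right_inv (hO hq)⟩
  refine h.not_isHopf_and_isCParallel hm (q := φ x₀) ?_ ?_ hx₀
  · intro q hq
    obtain ⟨hx, hxq⟩ := hpt q hq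
    obtain ⟨v, α, h1, h2⟩ := hH U _ hUo hN _ hx
    refine ⟨mfderiv 𝓘(ℝ, Model m) 𝓘(ℝ, Model m) φ (φ.symm q) v, α, ?_, ?_⟩
    · rw [hdP _ hx.1, hxq] at h1
      refine h1.trans ?_
      rw [reeb, hxq]
      rfl
    · rw [shape, covAlong, hdir (fun _ _ => rfl) _ hx (by
        rw [hxq]; exact h.differentiableAt_normal hq), hxq, reeb, hxq] at h2
      exact h2
  · intro Y hYc hYt hYn q hq V hV
    obtain ⟨hx, hxq⟩ := hpt q hq
    have hYd : DifferentiableAt ℝ Y q :=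
      (hYc.contDiffAt (h.isOpen.mem_nhds hq)).differentiableAt (by simp)
    have hNd := h.differentiableAt_normal hq
    have hY : IsTangentFieldOn f U (fun x => Y (φ x)) := by
      refine ⟨hsm hYc, fun x hx => ?_⟩
      obtain ⟨u, hu⟩ := h.range _ hx.2 (Y (φ x)) (hYt _ hx.2) (hYn _ hx.2)
      obtain ⟨v, hv⟩ := (hbij x hx.1).2 u
      exact ⟨v, by rw [hdP x hx.1, hv, hu]⟩
    obtain ⟨v, hv⟩ := (hbij _ hx.1).2 V
    have key := hC U _ _ hUo hN hY _ hx v (by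
      rw [hdP _ hx.1, hv, reeb, hxq]; exact hV)
    -- Needed on all of the open set `U`, since the normal Jacobi field is differentiated next.
    have hR : ∀ x ∈ U, normalJacobi f (fun x => N (φ x)) x (Y (φ x)) =
        curvForm (Y (φ x)) (N (φ x)) (N (φ x)) := fun x hx => by
      rw [normalJacobi, ← hPφ x hx.1]
      exact curvature_eq (hQ _ (hO hx.2)) (hYt _ hx.2) (h.tangent _ hx.2) (h.tangent _ hx.2)
    have hcd : DifferentiableAt ℝ (fun q => curvForm (Y q) (N q) (N q)) q := by
      have hK : ContDiffAt ℝ ∞ (fun q => Y q * N q - N q * Y q) q :=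
        ((hYc.contDiffAt (h.isOpen.mem_nhds hq)).mul (h.contDiffAt_normal hq)).sub
          ((h.contDiffAt_normal hq).mul (hYc.contDiffAt (h.isOpen.mem_nhds hq)))
      exact ((((hK.sub hK.mat_transp).mul (h.contDiffAt_normal hq)).sub
        ((h.contDiffAt_normal hq).mul (hK.sub hK.mat_transp)))).differentiableAt (by simp)
    have hP : IsQuadricPoint (P q) := hQ q (hO hq)
    rw [covNormalJacobi, covHyp, covHyp, covAlong, covAlong, hdir hR _ hx (by rwa [hxq]),
      hdir (fun _ _ => rfl) _ hx (by rwa [hxq]), hv, hxq, normalJacobi, hxq] at key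
    rw [curvature_eq (P := emb f (φ.symm q)) hP] at key
    · exact key
    · change tangentProj (P q) _ = _
      rw [tangentProj_sub, tangentProj_smul, h.tangent q hq]
      exact congrArg (· - _) (hP.tangentProj_tangentProj _)
    · exact h.tangent q hq
    · exact h.tangent q hq

end ComplexQuadric

end
theorem theorem1 (m : ℕ) (hm : 3 ≤ m) {M : Type*} [TopologicalSpace M] [Nonempty M]
    [ChartedSpace (ComplexQuadric.Model m) M] [IsManifold 𝓘(ℝ, ComplexQuadric.Model m) ∞ M]
    (f : M → ComplexQuadric.CP m) (hf : ComplexQuadric.IsRealHypersurface f) :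
    ¬ (ComplexQuadric.IsHopf f ∧ ComplexQuadric.HasCParallelNormalJacobi f) :=
  ComplexQuadric.not_isHopf_and_hasCParallelNormalJacobi hm hf
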